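/- **Setting.** Let $X\subset\mathbb R^n$ be compact and convex, $c\in\mathbb R^n$, $A\in\mathbb R^{r\times n}$ of full row rank, $b\in\mathbb R^r$. For $i\in[m]$ let $Z^i=\bigcap_{l=1}^{s_i}Z^{i,l}\subset\mathbb R^{d_i}$ ($s_i\ge1$) with $Z^{i,l}$ compact and convex, and let $g_i$ be bounded on $X\times Z^{i,s_i}$, convex in $x\in X$ and concave in $z\in Z^{i,s_i}$. (A set $X=\bigcap_jX_j$ is covered by copying $x$ and including the equalities between the copies in $Ax=b$.) Put $f_i(x)=\max_{z\in Z^i}g_i(x,z)$ and consider $$\min\{c^\top x:\ x\in X,\ f_i(x)\le0\ (i\in[m]),\ Ax=b\},\qquad L(x,(\lambda,w))=c^\top x+\sum_i\lambda_if_i(x)+w^\top(Ax-b).$$ Assume: (1) an optimal solution exists; (2) there are $\hat x\in\operatorname{int}X$ and $\hat\epsilon>0$ with $A\hat x=b$, and $\hat x+y\in X$, $f_i(\hat x+y)<0$ for all $i$ and all $\|y\|\le\hat\epsilon$; (3) the ball $B(0,\epsilon_i)$, $\epsilon_i>0$, is contained in $Z^i$; (4) $-g_i(x,0)\le\bar\mu_i$,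 $\bar\mu_i>0$, for all feasible $x$. Let $\underline v$ be a strict lower bound on the optimal value and put $$\bar\lambda=\frac{c^\top\hat x-\underline v}{\min_i(-f_i(\hat x))},\qquad R_w=\frac1{\sigma_{\min}(A)}\Big(\frac{c^\top\hat x-\underline v}{\hat\epsilon}+\|c\|\Big),\qquad W=\{w:\|w\|\le R_w\},$$ $$\tilde U^{i,l}=\{(\lambda z,\lambda):z\in Z^{i,l},\,0\le\lambda\le\bar\lambda\},\qquad \Omega^{i,l}=\{(\nu,\mu)\in\mathbb R^{d_i}\times\mathbb R:-\bar\mu_i\le\mu\le0,\ \|\nu\|\le-\mu/\epsilon_i\}.$$ (When $r=0$, $W=\{0\}$.) Let $\tilde g_i(x,(\tilde z,\lambda))=\lambda g_i(x,\tilde z/\lambda)$, equal to $0$ for $\lambda=0$. For $\chi=(x,\omega)\in\mathcal X=X\times\prod_{i}\prod_{l<s_i}\Omega^{i,l}$ and $y=(\tilde u,w)\in\mathcal Y=\prod_i\prod_{l\le s_i}\tilde U^{i,l}\times W$, with $\tilde u_i=(u_{i,1},\dots,u_{i,s_i})$, put $$\breve L(\chi,y)=c^\top x+w^\top(Ax-b)+\sum_i\tilde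 g_i(x,u_{i,s_i})+\sum_i\sum_{l<s_i}\omega_{i,l}^\top(u_{i,l}-u_{i,s_i}).$$ **Algorithm (SGSP).** Let $\tilde\tau,\tilde\theta_i,\tilde\theta_w>0$, $N\ge1$, $\tau=\tilde\tau/\sqrt N$, $\theta_i=\tilde\theta_i/\sqrt N$, $\theta_w=\tilde\theta_w/\sqrt N$. Start from $\chi^0\in\mathcal X$, $y^0\in\mathcal Y$ with $\lambda^0_{i,l}=\lambda^0_{i,1}=:\lambda_i^0$ for all $l$. For $0\le k<N$ let $z_i^k=\tilde z^k_{i,s_i}/\lambda^k_{i,s_i}$ ($z_i^k=0$ if $\lambda^k_{i,s_i}=0$), choose $d^k_{x,i}\in\partial_xg_i(x^k,z_i^k)$ and $d^k_{z,i}\in\partial_z(-g_i)(x^k,z_i^k)$ (for the functions $g_i(\cdot,z_i^k)$ on $X$ and $-g_i(x^k,\cdot)$ on $Z^{i,s_i}$), and put $$\chi^{k+1}=P_{\mathcal X}(\chi^k-\tau v_\chi^k),\quad u^{k+1}_{i,l}=P_{\tilde U^{i,l}}(u^k_{i,l}-\theta_iv^k_{i,l})\ (l\le s_i),\quad w^{k+1}=P_W(w^k+\theta_w(Ax^k-b)),$$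 where the $x$-part of $v_\chi^k$ is $c+A^\top w^k+\sum_i\lambda^k_{i,s_i}d^k_{x,i}$, its $\omega_{i,l}$-part is $u^k_{i,l}-u^k_{i,s_i}$, $v^k_{i,l}=-\omega^k_{i,l}$ for $l<s_i$, and $v^k_{i,s_i}=(d^k_{z,i},\,-g_i(x^k,z_i^k)-(z_i^k)^\top d^k_{z,i})+\sum_{l<s_i}\omega^k_{i,l}$; these are subgradients of $\breve L$ in $\chi$ and of $-\breve L$ in $\tilde u_i$. Assume $\|d^k_{x,i}\|\le G_{x,i}$ and $\|d^k_{z,i}\|\le G_{z,i}$ for all $k<N$. Let $\bar\chi^N=(\bar x^N,\bar\omega^N)=\frac1N\sum_{k=0}^{N-1}\chi^k$ and $\bar y^N=\frac1N\sum_{k=0}^{N-1}y^k$. **Constants.** With $R_x=\max_{x\in X}\|x\|$, $R_{i,l}=\max_{z\in Z^{i,l}}\|z\|$, $\bar g_i=\sup_{x\in X,\,z\in Z^{i,s_i}}|g_i(x,z)|$, let $$G_\chi=\|c\|+\|A\|R_w+\sum_i\bar\lambda G_{x,i}+\bar\lambda\sum_i\Big((s_i-1)(2+R_{i,s_i})+\sum_{l<s_i}R_{i,l}\Big),$$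 $$G_{\tilde u_i}=(1+R_{i,s_i})G_{z,i}+\bar g_i+2\bar\mu_i(s_i-1)(1+1/\epsilon_i),\qquad G_w=\|A\|R_x+\|b\|,\qquad \sigma_i=\sum_{l\le s_i}(1+4R_{i,l}^2),$$ $$\phi=\tilde\tau G_\chi^2+\sum_i\tilde\theta_iG_{\tilde u_i}^2+\frac4{\tilde\tau}\Big(\sum_i\bar\mu_i(s_i-1)(1+1/\epsilon_i)\Big)^2+\tilde\theta_wG_w^2 .$$ **Claim.** (i) For every $N\ge1$, every sequence generated by SGSP, and all $\chi\in\mathcal X$, $y=(\tilde u,w)\in\mathcal Y$, $$\breve L(\bar\chi^N,y)-\breve L(\chi,\bar y^N)\le\frac1{2\sqrt N}\Big(\frac{\|\chi^0-\chi\|^2}{\tilde\tau}+\tilde\tau G_\chi^2+\sum_i\Big(\frac{\|\tilde u_i^0-\tilde u_i\|^2}{\tilde\theta_i}+\tilde\theta_iG_{\tilde u_i}^2\Big)+\frac{\|w^0-w\|^2}{\tilde\theta_w}+\tilde\theta_wG_w^2\Big).$$ (ii) For every optimal solution $x^*$, every optimal solution $(\lambda^*,w^*)$ of the dual problem $\sup_{\lambda\ge0,w}\inf_{x\in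 X}L$, and all $\lambda\in[0,\bar\lambda]^m$, $w\in W$, $$L(\bar x^N,(\lambda,w))-L(x^*,(\lambda^*,w^*))\le\frac1{2\sqrt N}\Big(\tilde\tau^{-1}\|x^*-x^0\|^2+\sum_i\sigma_i\tilde\theta_i^{-1}\max\{\lambda_i,\lambda_i^0\}^2+4\tilde\theta_w^{-1}\max\{\|w\|,\|w^0\|\}^2+\phi\Big)$$ and $$L(\bar x^N,(\lambda^*,w^*))\ge c^\top x^*.$$ (iii) SGSP is $\psi$-ergodically bounded with $\psi(N)=1/(2\sqrt N)$: there are constants $\phi',\beta\ge0$ and $\tau',\theta_i',\theta_w'>0$, independent of $N$ and of the run, such that for every $N\ge1$, every run, every saddle point $(x^*,(\lambda^*,w^*))$ of $L$ over $X\times(\mathbb R^m_+\times\mathbb R^r)$, all $\lambda\in\mathbb R^m_+$, $w\in\mathbb R^r$ and $\alpha\ge0$, $$L(\bar x^N,(\lambda,w))-L(x^*,(\lambda^*,w^*))+\alpha\operatorname{dist}(\bar x^N,X)\le\psi(N)\Big(\frac{\|x^*-x^0\|^2}{\tau'}+\sum_i\frac{\max\{\lambda_i,\lambda_i^0\}^2}{\theta_i'}+\frac{\max\{\|w\|,\|w^0\|\}^2}{\theta_w'}+\phi'(1+\alpha^2)\Big)$$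 and $L(\bar x^N,(\lambda^*,w^*))-L(x^*,(\lambda^*,w^*))+\beta\operatorname{dist}(\bar x^N,X)\ge0$. -/

import Mathlib

open Filter Topology

noncomputable section

namespace RobustSGSP

/-- The Euclidean space `ℝ^k`. -/
abbrev Euc (k : ℕ) : Type := EuclideanSpace ℝ (Fin k)

/-- The lifted space `ℝ^k × ℝ` of pairs `u = (z̃, lam)`, with the Euclidean norm. -/
abbrev Lift (k : ℕ) : Type := WithLp 2 (Euc k × ℝ)

/-- The data of the robust problem: minimize `cᵀx` over `x ∈ X` subject to `A x = b` and
`g i x z ≤ 0` for all `z ∈ Z^i = ⋂ l, Z i l`. The number of sets intersected in `Z^i` is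
`s i = t i + 1`; the distinguished last copy `l = s i` is `Fin.last (t i)`, and the other copies
`l ∈ [s i - 1]` are the `l.castSucc` with `l : Fin (t i)`. -/
structure RobustProblem (n r m : ℕ) where
  c : Euc n
  A : Euc n →L[ℝ] Euc r
  b : Euc r
  X : Set (Euc n)
  d : Fin m → ℕ
  t : Fin m → ℕ
  Z : ∀ i, Fin (t i + 1) → Set (Euc (d i))
  g : ∀ i, Euc n → Euc (d i) → ℝ

/-- The scalars and points that the algorithm and its bounds are given: a Slater point `xhat` with
radius `epsHat`, a lower bound `vlow` on the optimal value, the radii `eps i` of balls inside `Z^i`,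
the bounds `mu i` on `-g i x 0`, the bounds `Gx i`, `Gz i` on the generated subgradients, and the
step-size parameters `tau`, `theta i`, `thetaW`. -/
structure Params (n m : ℕ) where
  xhat : Euc n
  epsHat : ℝ
  vlow : ℝ
  eps : Fin m → ℝ
  mu : Fin m → ℝ
  Gx : Fin m → ℝ
  Gz : Fin m → ℝ
  tau : ℝ
  theta : Fin m → ℝ
  thetaW : ℝ

/-- The radius `max {‖z‖ : z ∈ S}` of a (compact) set. -/
def radius {V : Type*} [Norm V] (S : Set V) : ℝ := sSup ((fun z => ‖z‖) '' S)

/-- `q` is the Euclidean projection of `p` onto `S`. -/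
def IsProj {V : Type*} [SeminormedAddCommGroup V] (S : Set V) (p q : V) : Prop :=
  q ∈ S ∧ ∀ s ∈ S, ‖p - q‖ ≤ ‖p - s‖

/-- The subdifferential at `x` of a function defined on the set `S`. -/
def subdiff {V : Type*} [NormedAddCommGroup V] [InnerProductSpace ℝ V]
    (S : Set V) (f : V → ℝ) (x : V) : Set V :=
  {v | ∀ y ∈ S, f x + inner ℝ v (y - x) ≤ f y}

/-- The ergodic mean `(1/N) ∑_{k=0}^{N-1} v^k`. -/
def ergodicMean {V : Type*} [AddCommGroup V] [Module ℝ V] (N : ℕ) (v : ℕ → V) : V :=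
  (N : ℝ)⁻¹ • ∑ k ∈ Finset.range N, v k

namespace RobustProblem

variable {n r m : ℕ} (P : RobustProblem n r m) (D : Params n m)

/-- The index `s i` of the distinguished copy. -/
abbrev top (i : Fin m) : Fin (P.t i + 1) := Fin.last (P.t i)

/-- The uncertainty set `Z^i = ⋂ l, Z^{i,l}`. -/
def Zint (i : Fin m) : Set (Euc (P.d i)) := ⋂ l, P.Z i l

/-- The robust constraint function `f_i(x) = max_{z ∈ Z^i} g_i(x, z)`. -/
def f (i : Fin m) (x : Euc n) : ℝ := sSup (P.g i x '' P.Zint i)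

/-- Standing assumptions of the model. Since the copy `z_{i,s_i}` ranges over `Z^{i,s_i}`, this is
the set on which `g_i(x, ·)` is defined, concave and bounded. -/
structure IsConvexModel : Prop where
  isCompact_X : IsCompact P.X
  convex_X : Convex ℝ P.X
  isCompact_Z : ∀ i l, IsCompact (P.Z i l)
  convex_Z : ∀ i l, Convex ℝ (P.Z i l)
  convexOn_g : ∀ i, ∀ z ∈ P.Z i (P.top i), ConvexOn ℝ P.X (fun x => P.g i x z)
  concaveOn_g : ∀ i, ∀ x ∈ P.X, ConcaveOn ℝ (P.Z i (P.top i)) (P.g i x)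
  bddAbove_g : ∀ i, BddAbove {a | ∃ x ∈ P.X, ∃ z ∈ P.Z i (P.top i), a = |P.g i x z|}

/-- The feasible set of the robust problem. -/
def feasible : Set (Euc n) := {x | x ∈ P.X ∧ (∀ i, P.f i x ≤ 0) ∧ P.A x = P.b}

/-- `x` is an optimal solution of the robust problem. -/
def IsOptimal (x : Euc n) : Prop :=
  x ∈ P.feasible ∧ ∀ x' ∈ P.feasible, inner ℝ P.c x ≤ inner ℝ P.c x'

/-- Slater condition with point `xhat` and radius `epsHat`. -/
def IsSlater (xhat : Euc n) (epsHat : ℝ) : Prop :=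
  xhat ∈ interior P.X ∧ P.A xhat = P.b ∧ 0 < epsHat ∧
    ∀ y : Euc n, ‖y‖ ≤ epsHat → xhat + y ∈ P.X ∧ ∀ i, P.f i (xhat + y) < 0

/-- The Lagrangian `L(x, (lam, w))`. -/
def lagr (x : Euc n) (lam : Fin m → ℝ) (w : Euc r) : ℝ :=
  inner ℝ P.c x + ∑ i, lam i * P.f i x + inner ℝ w (P.A x - P.b)

/-- `(x, (lam, w))` is a saddle point of `L` over `X × (ℝ^m_+ × ℝ^r)`. -/
def IsSaddle (x : Euc n) (lam : Fin m → ℝ) (w : Euc r) : Prop :=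
  x ∈ P.X ∧ (∀ i, 0 ≤ lam i) ∧
    (∀ (lam' : Fin m → ℝ) (w' : Euc r), (∀ i, 0 ≤ lam' i) → P.lagr x lam' w' ≤ P.lagr x lam w) ∧
    ∀ x' ∈ P.X, P.lagr x lam w ≤ P.lagr x' lam w

/-- The dual function `inf_{x ∈ X} L(x, (lam, w))`. -/
def dualFn (lam : Fin m → ℝ) (w : Euc r) : EReal := ⨅ x ∈ P.X, (P.lagr x lam w : EReal)

/-- `(lam, w)` is optimal for the dual problem `sup_{lam ≥ 0, w} inf_{x ∈ X} L(x, (lam, w))`. -/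
def IsDualOptimal (lam : Fin m → ℝ) (w : Euc r) : Prop :=
  (∀ i, 0 ≤ lam i) ∧
    ∀ (lam' : Fin m → ℝ) (w' : Euc r), (∀ i, 0 ≤ lam' i) → P.dualFn lam' w' ≤ P.dualFn lam w

/-! ### The bounded domains -/

/-- The bound `(cᵀxhat - vlow) / min_i (-f_i(xhat))` on the multipliers `lam i`. -/
def lambdaBar : ℝ := (inner ℝ P.c D.xhat - D.vlow) / ⨅ i, -P.f i D.xhat

/-- The smallest of the `r` singular values of `A` (equivalently, of its transpose). -/
def sigmaMin : ℝ := (LinearMap.adjoint (P.A : Euc n →ₗ[ℝ] Euc r)).singularValues (r - 1)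

/-- The radius `R_w` of the domain of `w`. -/
def radW : ℝ := 1 / P.sigmaMin * ((inner ℝ P.c D.xhat - D.vlow) / D.epsHat + ‖P.c‖)

/-- The domain `W` of `w`. -/
def W : Set (Euc r) := {w | ‖w‖ ≤ P.radW D}

/-- `Ũ^{i,l} = {(z̃, lam) : z̃ ∈ lam Z^{i,l}, 0 ≤ lam ≤ lambdaBar}`. -/
def U (i : Fin m) (l : Fin (P.t i + 1)) : Set (Lift (P.d i)) :=
  {u | 0 ≤ u.snd ∧ u.snd ≤ P.lambdaBar D ∧ ∃ z ∈ P.Z i l, u.fst = u.snd • z}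

/-- The set `Ω^{i,l}` of the multipliers `ω_{i,l} = (ν, μ)` (the same for all `l`). -/
def Omega (i : Fin m) : Set (Lift (P.d i)) :=
  {o | -D.mu i ≤ o.snd ∧ o.snd ≤ 0 ∧ ‖o.fst‖ ≤ -o.snd / D.eps i}

/-- The multipliers `ω = (ω_{i,l})`, `l ∈ [s i - 1]`. -/
abbrev OmegaSpace : Type := PiLp 2 fun i : Fin m => PiLp 2 fun _ : Fin (P.t i) => Lift (P.d i)

/-- The primal variables `χ = (x, ω)`, with the Euclidean norm. -/
abbrev Primal : Type := WithLp 2 (Euc n × P.OmegaSpace)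

/-- The copies `ũ_i = (u_{i,1}, …, u_{i,s_i})`, with the Euclidean norm. -/
abbrev Block (i : Fin m) : Type := PiLp 2 fun _ : Fin (P.t i + 1) => Lift (P.d i)

/-- The dual variables `y = (ũ, w)`. -/
abbrev Dual : Type := (∀ i, P.Block i) × Euc r

/-- The primal domain `𝒳`. -/
def primalDomain : Set P.Primal := {χ | χ.fst ∈ P.X ∧ ∀ i l, χ.snd i l ∈ P.Omega D i}

/-- The domain of `ũ_i`. -/
def blockDomain (i : Fin m) : Set (P.Block i) := {v | ∀ l, v l ∈ P.U D i l}

/-- The dual domain `𝒴`. -/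
def dualDomain : Set P.Dual := {y | (∀ i, y.1 i ∈ P.blockDomain D i) ∧ y.2 ∈ P.W D}

/-! ### The expanded Lagrangian -/

/-- `z = z̃ / lam` if `lam ≠ 0`, and `z = 0` otherwise. -/
def unlift {k : ℕ} (u : Lift k) : Euc k := u.snd⁻¹ • u.fst

/-- The perspective `g̃_i(x, (z̃, lam)) = lam g_i(x, z̃ / lam)`, equal to `0` at `lam = 0`. -/
def persp (i : Fin m) (x : Euc n) (u : Lift (P.d i)) : ℝ := u.snd * P.g i x (unlift u)

/-- The expanded Lagrangian `L̆(χ, y)`. -/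
def expLagr (χ : P.Primal) (y : P.Dual) : ℝ :=
  inner ℝ P.c χ.fst + inner ℝ y.2 (P.A χ.fst - P.b)
    + ∑ i, P.persp i χ.fst (y.1 i (P.top i))
    + ∑ i, ∑ l : Fin (P.t i), inner ℝ (χ.snd i l) (y.1 i l.castSucc - y.1 i (P.top i))

/-! ### The algorithm -/

/-- The subgradient `v_χ` of `L̆(·, y)` at `χ` built from subgradients `dx i` of `g_i(·, z_{i,s_i})`:
its `x`-part is `c + Aᵀw + ∑ i, lam_{i,s_i} dx i`, its `ω_{i,l}`-part is `u_{i,l} - u_{i,s_i}`. -/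
def gradPrimal (y : P.Dual) (dx : Fin m → Euc n) : P.Primal :=
  WithLp.toLp 2
    (P.c + ContinuousLinearMap.adjoint P.A y.2 + ∑ i, (y.1 i (P.top i)).snd • dx i,
      WithLp.toLp 2 fun i => WithLp.toLp 2 fun l : Fin (P.t i) =>
        y.1 i l.castSucc - y.1 i (P.top i))

/-- The subgradient `v_{ũ_i}` of `-L̆(χ, ·)` in the block `ũ_i`, built from a subgradient `dz` of
`-g_i(x, ·)` at `z = z_{i,s_i}`: its `u_{i,l}`-part is `-ω_{i,l}` for `l < s_i`, and its
`u_{i,s_i}`-part is `(dz, -g_i(x, z) - zᵀdz) + ∑ l, ω_{i,l}`. -/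
def gradBlock (χ : P.Primal) (y : P.Dual) (i : Fin m) (dz : Euc (P.d i)) : P.Block i :=
  WithLp.toLp 2 (Fin.snoc (α := fun _ => Lift (P.d i))
    (fun l : Fin (P.t i) => -(χ.snd i l))
    (WithLp.toLp 2 (dz, -P.g i χ.fst (unlift (y.1 i (P.top i)))
        - inner ℝ (unlift (y.1 i (P.top i))) dz)
      + ∑ l : Fin (P.t i), χ.snd i l))

/-- `(χ^k, y^k)` is a sequence generated by `N` steps of SGSP for the expanded Lagrangian, with step
sizes `tau / √N`, `theta i / √N`, `thetaW / √N`, and with `dx k i ∈ ∂_x g_i(x^k, z^k_{i,s_i})` and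
`dz k i ∈ ∂_z (-g_i)(x^k, z^k_{i,s_i})` the subgradients of the `g_i` that it uses. -/
structure IsRun (N : ℕ) (χ : ℕ → P.Primal) (y : ℕ → P.Dual)
    (dx : ℕ → Fin m → Euc n) (dz : ℕ → ∀ i, Euc (P.d i)) : Prop where
  init_primal : χ 0 ∈ P.primalDomain D
  init_dual : y 0 ∈ P.dualDomain D
  init_lam : ∀ i l, ((y 0).1 i l).snd = ((y 0).1 i 0).snd
  dx_mem : ∀ k < N, ∀ i,
    dx k i ∈ subdiff P.X (fun x => P.g i x (unlift ((y k).1 i (P.top i)))) (χ k).fst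
  dz_mem : ∀ k < N, ∀ i,
    dz k i ∈ subdiff (P.Z i (P.top i)) (fun z => -P.g i (χ k).fst z)
      (unlift ((y k).1 i (P.top i)))
  dx_le : ∀ k < N, ∀ i, ‖dx k i‖ ≤ D.Gx i
  dz_le : ∀ k < N, ∀ i, ‖dz k i‖ ≤ D.Gz i
  step_primal : ∀ k < N,
    IsProj (P.primalDomain D) (χ k - (D.tau / √N) • P.gradPrimal (y k) (dx k)) (χ (k + 1))
  step_block : ∀ k < N, ∀ i,
    IsProj (P.blockDomain D i)
      ((y k).1 i - (D.theta i / √N) • P.gradBlock (χ k) (y k) i (dz k i)) ((y (k + 1)).1 i)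
  step_w : ∀ k < N,
    IsProj (P.W D) ((y k).2 + (D.thetaW / √N) • (P.A (χ k).fst - P.b)) (y (k + 1)).2

/-- SGSP as a method for the saddle point problem of `L`: `N` steps from the initial point
`(x0, (lam0, w0))` can produce the ergodic mean `xbar`. -/
def sgsp (N : ℕ) (x0 : Euc n) (lam0 : Fin m → ℝ) (w0 : Euc r) (xbar : Euc n) : Prop :=
  ∃ χ y dx dz, P.IsRun D N χ y dx dz ∧ (χ 0).fst = x0 ∧
    (∀ i, ((y 0).1 i (P.top i)).snd = lam0 i) ∧ (y 0).2 = w0 ∧ (ergodicMean N χ).fst = xbar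

/-- The `ψ`-ergodic boundedness of a method `alg` for the saddle point problem of `L`, where
`alg N x0 lam0 w0 xbar` says that `N` iterations from the initial point `(x0, (lam0, w0))` can
produce the ergodic mean `xbar`. -/
def IsErgodicallyBounded (ψ : ℕ → ℝ)
    (alg : ℕ → Euc n → (Fin m → ℝ) → Euc r → Euc n → Prop) : Prop :=
  (∀ N, 1 ≤ N → 0 ≤ ψ N) ∧ AntitoneOn ψ (Set.Ici 1) ∧ Tendsto ψ atTop (𝓝 0) ∧
  ∃ (φ τ β θW : ℝ) (θ : Fin m → ℝ),
    0 ≤ φ ∧ 0 < τ ∧ 0 ≤ β ∧ 0 < θW ∧ (∀ i, 0 < θ i) ∧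
    ∀ N, 1 ≤ N → ∀ x0 lam0 w0 xbar, alg N x0 lam0 w0 xbar →
      ∀ xs lams ws, P.IsSaddle xs lams ws →
        (∀ (lam : Fin m → ℝ) (w : Euc r) (α : ℝ), (∀ i, 0 ≤ lam i) → 0 ≤ α →
          P.lagr xbar lam w - P.lagr xs lams ws + α * Metric.infDist xbar P.X ≤
            ψ N * (τ⁻¹ * ‖xs - x0‖ ^ 2 + ∑ i, (θ i)⁻¹ * max (lam i) (lam0 i) ^ 2
              + θW⁻¹ * max ‖w‖ ‖w0‖ ^ 2 + φ * (1 + α ^ 2))) ∧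
        0 ≤ P.lagr xbar lams ws - P.lagr xs lams ws + β * Metric.infDist xbar P.X

/-! ### The constants -/

/-- `ḡ_i = max |g_i(x, z)|` over `x ∈ X` and `z ∈ Z^{i,s_i}`. -/
def gbar (i : Fin m) : ℝ := sSup {a | ∃ x ∈ P.X, ∃ z ∈ P.Z i (P.top i), a = |P.g i x z|}

/-- The subgradient bound `G_χ`. -/
def gPrimal : ℝ :=
  ‖P.c‖ + ‖P.A‖ * P.radW D + ∑ i, P.lambdaBar D * D.Gx i
    + P.lambdaBar D * ∑ i, ((P.t i : ℝ) * (2 + radius (P.Z i (P.top i)))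
      + ∑ l : Fin (P.t i), radius (P.Z i l.castSucc))

/-- The subgradient bound `G_{ũ_i}`. -/
def gBlock (i : Fin m) : ℝ :=
  (1 + radius (P.Z i (P.top i))) * D.Gz i + P.gbar i
    + 2 * D.mu i * (P.t i : ℝ) * (1 + 1 / D.eps i)

/-- The subgradient bound `G_w`. -/
def gW : ℝ := ‖P.A‖ * radius P.X + ‖P.b‖

/-- `σ_i = ∑_l (1 + 4 R_{i,l}²)`. -/
def sigma (i : Fin m) : ℝ := ∑ l, (1 + 4 * radius (P.Z i l) ^ 2)

/-- The constant `φ`. -/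
def phi : ℝ :=
  D.tau * P.gPrimal D ^ 2 + ∑ i, D.theta i * P.gBlock D i ^ 2
    + 4 * (∑ i, D.mu i * (P.t i : ℝ) * (1 + 1 / D.eps i)) ^ 2 / D.tau
    + D.thetaW * P.gW ^ 2

end RobustProblem

end RobustSGSP

end

namespace RobustSGSP

/-! ### Projected subgradient steps -/

/-! The expanded Lagrangian is convex in χ and concave in y: each perspective `persp` is concave in
the lifted variable, the coupling terms are bilinear, and the vectors used by the method are
subgradients. A projected subgradient step does not increase the distance to a comparison point by
more than its linearization and squared length allow, so the regrets telescope
(`average_inner_le_of_isProj`). Adding the regrets of all blocks and applying Jensen to the ergodic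
means gives the gap of the expanded Lagrangian, `IsRun.expLagr_gap_le`.

Two choices of comparison point transfer this gap to `lagr`. On the primal side, for feasible x the
inequality f_i(x) ≤ 0 is a statement about an intersection of convex sets; dualizing the equality of
the copies yields multipliers in `Omega` for which the expanded Lagrangian is at most cᵀx on the
whole dual domain (`exists_affine_majorant`, `exists_omega`). The ball inside Z^i bounds these
multipliers. On the dual side, equal copies at a near maximizer of g_i cancel the coupling terms and
recover `lagr` up to an arbitrarily small error (`exists_lagr_le_expLagr`). Slater's condition gives
strong duality, so that every dual optimal pair satisfies L ≥ cᵀx* on X.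

For ergodic boundedness the dual variables are unrestricted. Since `vlow` lies strictly below the
optimal value, saddle multipliers stay at a uniform distance δ from the upper bound on λ and from
the boundary of `W` (`exists_margin`). The Lagrangian is affine in (λ, w), so a bound B on its gap
over the bounded domain forces f_i(x̄) ≤ B/δ and ‖Ax̄ - b‖ ≤ B/δ. Hence the gap grows at most
linearly in (λ, w) (`lagr_sub_le_of_box`), and quadratic terms absorb linear growth. The mean x̄
lies in X, so the distance terms vanish. -/

theorem IsProj.inner_sub_le_zero {V : Type*} [NormedAddCommGroup V] [InnerProductSpace ℝ V]
    {S : Set V} (hS : Convex ℝ S) {p q : V} (h : IsProj S p q) {s : V} (hs : s ∈ S) :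
    inner ℝ (p - q) (s - q) ≤ 0 := by
  refine (norm_eq_iInf_iff_real_inner_le_zero hS h.1).1 ?_ s hs
  have : Nonempty S := ⟨⟨q, h.1⟩⟩
  refine le_antisymm (le_ciInf fun w => h.2 w w.2) ?_
  exact ciInf_le (f := fun w : S => ‖p - w‖) ⟨0, by rintro _ ⟨w, rfl⟩; positivity⟩ ⟨q, h.1⟩

theorem IsProj.norm_sub_sq_le {V : Type*} [NormedAddCommGroup V] [InnerProductSpace ℝ V]
    {S : Set V} (hS : Convex ℝ S) {p q : V} (h : IsProj S p q) {s : V} (hs : s ∈ S) :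
    ‖q - s‖ ^ 2 ≤ ‖p - s‖ ^ 2 := by
  have h1 := h.inner_sub_le_zero hS hs
  have h2 : p - s = (p - q) - (s - q) := by abel
  have h3 := norm_sub_sq_real (p - q) (s - q)
  rw [h2, h3, norm_sub_rev q s]
  nlinarith [sq_nonneg ‖p - q‖]

/-- Expanding ‖p k - η v k - s‖² isolates the inner product, projection can only bring the iterate
closer to s, and the squared distances telescope. -/
theorem sum_inner_le_of_isProj {V : Type*} [NormedAddCommGroup V] [InnerProductSpace ℝ V]
    {S : Set V} (hS : Convex ℝ S) {p v : ℕ → V} {N : ℕ} {η G : ℝ}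
    (hstep : ∀ k < N, IsProj S (p k - η • v k) (p (k + 1))) (hG : ∀ k < N, ‖v k‖ ≤ G)
    {s : V} (hs : s ∈ S) :
    2 * η * ∑ k ∈ Finset.range N, inner ℝ (v k) (p k - s) ≤
      ‖p 0 - s‖ ^ 2 - ‖p N - s‖ ^ 2 + N * (η ^ 2 * G ^ 2) := by
  induction N with
  | zero => simp
  | succ N ih =>
    have h1 := ih (fun k hk => hstep k (by omega)) (fun k hk => hG k (by omega))
    have h2 := (hstep N (by omega)).norm_sub_sq_le hS hs
    have h3 : p N - η • v N - s = (p N - s) - η • v N := by abel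
    rw [h3, norm_sub_sq_real (p N - s), norm_smul, inner_smul_right, real_inner_comm, Real.norm_eq_abs,
      mul_pow, sq_abs] at h2
    have h4 : ‖v N‖ ^ 2 ≤ G ^ 2 := pow_le_pow_left₀ (norm_nonneg _) (hG N (by omega)) 2
    have h5 := mul_le_mul_of_nonneg_left h4 (sq_nonneg η)
    rw [Finset.sum_range_succ, mul_add]
    push_cast
    linarith

/-- The averaged regret of `N` projected subgradient steps of length `θ / √N`. -/
theorem average_inner_le_of_isProj {V : Type*} [NormedAddCommGroup V] [InnerProductSpace ℝ V]
    {S : Set V} (hS : Convex ℝ S) {p v : ℕ → V} {N : ℕ} (hN : 1 ≤ N) {θ G : ℝ} (hθ : 0 < θ)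
    (hstep : ∀ k < N, IsProj S (p k - (θ / √N) • v k) (p (k + 1))) (hG : ∀ k < N, ‖v k‖ ≤ G)
    {s : V} (hs : s ∈ S) :
    (N : ℝ)⁻¹ * ∑ k ∈ Finset.range N, inner ℝ (v k) (p k - s) ≤
      1 / (2 * √N) * (‖p 0 - s‖ ^ 2 / θ + θ * G ^ 2) := by
  have hN' : (0 : ℝ) < N := by exact_mod_cast hN
  have hr : 0 < √(N : ℝ) := Real.sqrt_pos.2 hN'
  have h := sum_inner_le_of_isProj hS hstep hG hs
  have hsq : √(N : ℝ) ^ 2 = N := Real.sq_sqrt hN'.le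
  generalize √(N : ℝ) = q at *
  rw [← hsq] at h ⊢
  have h' : 2 * (θ / q) * ∑ k ∈ Finset.range N, inner ℝ (v k) (p k - s) ≤
      ‖p 0 - s‖ ^ 2 + θ ^ 2 * G ^ 2 := by
    have e : q ^ 2 * ((θ / q) ^ 2 * G ^ 2) = θ ^ 2 * G ^ 2 := by field_simp
    rw [e] at h
    linarith [sq_nonneg ‖p N - s‖]
  have e1 : (q ^ 2)⁻¹ * ∑ k ∈ Finset.range N, inner ℝ (v k) (p k - s) =
      (1 / (2 * q * θ)) * (2 * (θ / q) * ∑ k ∈ Finset.range N, inner ℝ (v k) (p k - s)) := by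
    field_simp
  have e2 : 1 / (2 * q) * (‖p 0 - s‖ ^ 2 / θ + θ * G ^ 2) =
      (1 / (2 * q * θ)) * (‖p 0 - s‖ ^ 2 + θ ^ 2 * G ^ 2) := by
    field_simp
  rw [e1, e2]
  exact mul_le_mul_of_nonneg_left h' (by positivity)

/-! ### Ergodic means -/

theorem ergodicMean_eq_sum {V : Type*} [AddCommGroup V] [Module ℝ V] (N : ℕ) (v : ℕ → V) :
    ergodicMean N v = ∑ k ∈ Finset.range N, (N : ℝ)⁻¹ • v k := by
  rw [ergodicMean, Finset.smul_sum]

theorem sum_range_inv {N : ℕ} (hN : 1 ≤ N) : ∑ _k ∈ Finset.range N, (N : ℝ)⁻¹ = 1 := by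
  have : (N : ℝ) ≠ 0 := by positivity
  simp [this]

theorem _root_.Convex.ergodicMean_mem {V : Type*} [AddCommGroup V] [Module ℝ V] {S : Set V}
    (hS : Convex ℝ S) {N : ℕ} (hN : 1 ≤ N) {v : ℕ → V} (hv : ∀ k < N, v k ∈ S) :
    ergodicMean N v ∈ S := by
  rw [ergodicMean_eq_sum]
  exact hS.sum_mem (fun _ _ => by positivity) (sum_range_inv hN)
    fun k hk => hv k (Finset.mem_range.1 hk)

theorem _root_.ConvexOn.map_ergodicMean_le {V : Type*} [AddCommGroup V] [Module ℝ V] {S : Set V}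
    {f : V → ℝ} (hf : ConvexOn ℝ S f) {N : ℕ} (hN : 1 ≤ N) {v : ℕ → V} (hv : ∀ k < N, v k ∈ S) :
    f (ergodicMean N v) ≤ ergodicMean N fun k => f (v k) := by
  rw [ergodicMean_eq_sum, ergodicMean_eq_sum]
  exact hf.map_sum_le (fun _ _ => by positivity) (sum_range_inv hN)
    fun k hk => hv k (Finset.mem_range.1 hk)

theorem _root_.ConcaveOn.le_map_ergodicMean {V : Type*} [AddCommGroup V] [Module ℝ V] {S : Set V}
    {f : V → ℝ} (hf : ConcaveOn ℝ S f) {N : ℕ} (hN : 1 ≤ N) {v : ℕ → V} (hv : ∀ k < N, v k ∈ S) :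
    (ergodicMean N fun k => f (v k)) ≤ f (ergodicMean N v) := by
  rw [ergodicMean_eq_sum, ergodicMean_eq_sum]
  exact hf.le_map_sum (fun _ _ => by positivity) (sum_range_inv hN)
    fun k hk => hv k (Finset.mem_range.1 hk)

/-! ### Norms of direct sums -/

theorem norm_le_norm_fst_add_norm_snd {V V' : Type*} [SeminormedAddCommGroup V]
    [SeminormedAddCommGroup V'] (u : WithLp 2 (V × V')) : ‖u‖ ≤ ‖u.fst‖ + ‖u.snd‖ := by
  rw [WithLp.prod_norm_eq_of_L2, Real.sqrt_le_left (by positivity)]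
  nlinarith [norm_nonneg u.fst, norm_nonneg u.snd]

theorem norm_le_sum_norm {ι : Type*} [Fintype ι] {V : ι → Type*}
    [∀ i, SeminormedAddCommGroup (V i)] (u : PiLp 2 V) : ‖u‖ ≤ ∑ i, ‖u i‖ := by
  rw [PiLp.norm_eq_of_L2, Real.sqrt_le_left (Finset.sum_nonneg fun _ _ => norm_nonneg _)]
  exact Finset.sum_sq_le_sq_sum_of_nonneg fun _ _ => norm_nonneg _

theorem le_radius {V : Type*} [SeminormedAddCommGroup V] {S : Set V} (hS : IsCompact S) {z : V}
    (hz : z ∈ S) : ‖z‖ ≤ radius S :=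
  le_csSup (hS.image continuous_norm).bddAbove ⟨z, hz, rfl⟩

/-! ### Convex duality -/

/-- If a convex hypograph over a neighbourhood of `0` has no point above `0` over `0`, then it lies
below a linear functional. -/
theorem exists_le_of_convex_hypograph {F : Type*} [NormedAddCommGroup F] [NormedSpace ℝ F]
    {K : Set (F × ℝ)} (hK : Convex ℝ K) (hdown : ∀ y s s', (y, s) ∈ K → s' ≤ s → (y, s') ∈ K)
    {M : ℝ} (hM : ∀ᶠ y in 𝓝 (0 : F), (y, M) ∈ K) (h0 : ∀ s, ((0 : F), s) ∈ K → s ≤ 0) :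
    ∃ p : F →L[ℝ] ℝ, ∀ y s, (y, s) ∈ K → s + p y ≤ 0 := by
  -- Downward closure thickens the points at height M over a neighbourhood of 0 into a full
  -- neighbourhood of any lower point.
  have hint : ((0 : F), M - 1) ∈ interior K := by
    rw [mem_interior_iff_mem_nhds, nhds_prod_eq]
    filter_upwards [hM.prod_mk (Iio_mem_nhds (show M - 1 < M by linarith))] with x hx
    exact hdown _ _ _ hx.1 (le_of_lt hx.2)
  have hnot : ((0 : F), (0 : ℝ)) ∉ interior K := by
    intro h
    rw [mem_interior_iff_mem_nhds, nhds_prod_eq] at h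
    have h1 : ∀ᶠ t in 𝓝 (0 : ℝ), ((0 : F), t) ∈ K := Filter.Eventually.curry_nhds (by
      rw [nhds_prod_eq]; exact h) |>.self_of_nhds
    obtain ⟨ε, hε, h2⟩ := Metric.eventually_nhds_iff.1 h1
    have := h0 _ (h2 (y := ε / 2) (by rw [Real.dist_eq, sub_zero, abs_of_pos] <;> linarith))
    linarith
  obtain ⟨φ, hφ⟩ := geometric_hahn_banach_open_point hK.interior isOpen_interior hnot
  have hz : φ (0, 0) = 0 := by
    have : ((0 : F), (0 : ℝ)) = 0 := rfl
    rw [this, map_zero]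
  rw [hz] at hφ
  have hle : ∀ a ∈ K, φ a ≤ 0 := by
    intro a ha
    have hcl : a ∈ closure (interior K) := by
      rw [hK.closure_interior_eq_closure_of_nonempty_interior ⟨_, hint⟩]
      exact subset_closure ha
    exact (isClosed_le φ.continuous continuous_const).closure_subset_iff.2
      (fun b hb => (hφ b hb).le) hcl
  have hsplit : ∀ y s, φ (y, s) = φ (y, 0) + s * φ (0, 1) := by
    intro y s
    rw [← smul_eq_mul, ← map_smul, ← map_add]
    simp
  have hM0 : M ≤ 0 := h0 M hM.self_of_nhds
  -- The separating hyperplane is not vertical: φ is negative at the interior point, whose height M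
  -- - 1 is negative. Dividing by φ(0, 1) then normalizes the last coordinate.
  have hq : 0 < φ (0, 1) := by
    have := hφ _ hint
    rw [hsplit, hz] at this
    nlinarith
  refine ⟨(φ (0, 1))⁻¹ • φ.comp (ContinuousLinearMap.inl ℝ F ℝ), fun y s h => ?_⟩
  have h1 := hle _ h
  rw [hsplit] at h1
  have h2 : s + ((φ (0, 1))⁻¹ • φ.comp (ContinuousLinearMap.inl ℝ F ℝ)) y =
      (φ (0, 1))⁻¹ * (φ (y, 0) + s * φ (0, 1)) := by
    simp only [smul_apply, ContinuousLinearMap.comp_apply,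
      ContinuousLinearMap.inl_apply, smul_eq_mul]
    field_simp
    ring
  rw [h2]
  exact mul_nonpos_of_nonneg_of_nonpos (inv_nonneg.2 hq.le) h1

/-! ### The smallest singular value -/

/-- In an orthonormal eigenbasis of T*T, ‖T w‖² is the sum of the squared coordinates of w weighted
by eigenvalues, each at least the square of the singular value with the last index. -/
theorem singularValues_mul_norm_le {E F : Type*} [NormedAddCommGroup E] [InnerProductSpace ℝ E]
    [FiniteDimensional ℝ E] [NormedAddCommGroup F] [InnerProductSpace ℝ F] [FiniteDimensional ℝ F]
    (T : E →ₗ[ℝ] F) (w : E) :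
    T.singularValues (Module.finrank ℝ E - 1) * ‖w‖ ≤ ‖T w‖ := by
  set σ := T.singularValues (Module.finrank ℝ E - 1) with hσ
  have hσ0 : 0 ≤ σ := T.singularValues_nonneg _
  have hT := T.isSymmetric_adjoint_comp_self
  let e := hT.eigenvectorBasis rfl
  have h1 : ‖T w‖ ^ 2 = ∑ i, hT.eigenvalues rfl i * inner ℝ (e i) w ^ 2 := by
    rw [← real_inner_self_eq_norm_sq, ← LinearMap.adjoint_inner_right, ← LinearMap.comp_apply,
      ← e.sum_inner_mul_inner]
    refine Finset.sum_congr rfl fun i _ => ?_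
    rw [← hT (e i) w, hT.apply_eigenvectorBasis rfl i]
    simp only [RCLike.ofReal_real_eq_id, id_eq, inner_smul_left, conj_trivial]
    rw [real_inner_comm]
    ring
  have h2 : σ ^ 2 * ‖w‖ ^ 2 ≤ ‖T w‖ ^ 2 := by
    rw [h1, ← real_inner_self_eq_norm_sq w, ← e.sum_inner_mul_inner, Finset.mul_sum]
    refine Finset.sum_le_sum fun i _ => ?_
    have h3 : σ ^ 2 ≤ hT.eigenvalues rfl i := by
      rw [← T.sq_singularValues_fin rfl i]
      exact pow_le_pow_left₀ hσ0 (T.singularValues_antitone (by omega)) 2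
    rw [real_inner_comm w (e i)]
    nlinarith [sq_nonneg (inner ℝ w (e i) : ℝ)]
  rw [← mul_pow] at h2
  exact le_of_sq_le_sq h2 (norm_nonneg _)

namespace RobustProblem

variable {n r m : ℕ} {P : RobustProblem n r m} {D : Params n m}

/-! ### The lifted uncertainty sets -/

/-- At scalar 0 the point `unlift u` is 0, so 0 ∈ Z is exactly what makes it a valid representative
there. Elsewhere the representative is unique. -/
theorem mem_U_iff {i : Fin m} {l : Fin (P.t i + 1)} (h0 : 0 ∈ P.Z i l) {u : Lift (P.d i)} :
    u ∈ P.U D i l ↔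
      0 ≤ u.snd ∧ u.snd ≤ P.lambdaBar D ∧ unlift u ∈ P.Z i l ∧ u.fst = u.snd • unlift u := by
  refine ⟨fun ⟨h1, h2, z, hz, hu⟩ => ⟨h1, h2, ?_⟩, fun ⟨h1, h2, h3, h4⟩ => ⟨h1, h2, _, h3, h4⟩⟩
  rcases eq_or_ne u.snd 0 with h | h
  · simp only [unlift, h, inv_zero, zero_smul] at hu ⊢
    exact ⟨h0, hu⟩
  · have : unlift u = z := by rw [unlift, hu, inv_smul_smul₀ h]
    rw [this]
    exact ⟨hz, hu⟩

theorem convex_U (hm : P.IsConvexModel) (i : Fin m) (l : Fin (P.t i + 1)) :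
    Convex ℝ (P.U D i l) := by
  rintro u ⟨hu1, hu2, z, hz, hu⟩ v ⟨hv1, hv2, z', hz', hv⟩ a b ha hb hab
  have e : (a • u + b • v).snd = a * u.snd + b * v.snd := by simp
  refine ⟨by rw [e]; positivity, ?_, ?_⟩
  · rw [e]
    calc a * u.snd + b * v.snd ≤ a * P.lambdaBar D + b * P.lambdaBar D := by gcongr
      _ = P.lambdaBar D := by rw [← add_mul, hab, one_mul]
  · rw [e, WithLp.add_fst, WithLp.smul_fst, WithLp.smul_fst, hu, hv]
    have hp : 0 ≤ a * u.snd := by positivity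
    have hq : 0 ≤ b * v.snd := by positivity
    rcases (add_nonneg hp hq).eq_or_lt with h | h
    · have hp0 : a * u.snd = 0 := by linarith
      have hq0 : b * v.snd = 0 := by linarith
      exact ⟨z, hz, by simp [smul_smul, hp0, hq0]⟩
    · refine ⟨_, hm.convex_Z i l hz hz' (div_nonneg hp h.le) (div_nonneg hq h.le)
        (by rw [← add_div, div_self h.ne']), ?_⟩
      rw [smul_add, smul_smul, smul_smul, smul_smul, smul_smul, mul_div_cancel₀ _ h.ne',
        mul_div_cancel₀ _ h.ne']

theorem norm_le_of_mem_U (hm : P.IsConvexModel) {i : Fin m} {l : Fin (P.t i + 1)}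
    {u : Lift (P.d i)} (hu : u ∈ P.U D i l) :
    ‖u‖ ≤ P.lambdaBar D * (1 + radius (P.Z i l)) := by
  obtain ⟨h1, h2, z, hz, h⟩ := hu
  have hz' := le_radius (hm.isCompact_Z i l) hz
  have h3 := norm_le_norm_fst_add_norm_snd u
  rw [h, norm_smul, Real.norm_eq_abs, abs_of_nonneg h1] at h3
  have h4 : u.snd * ‖z‖ ≤ P.lambdaBar D * radius (P.Z i l) :=
    mul_le_mul h2 hz' (norm_nonneg _) (h1.trans h2)
  linarith

theorem convex_Omega (heps : ∀ i, 0 < D.eps i) (i : Fin m) : Convex ℝ (P.Omega D i) := by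
  rintro u ⟨hu1, hu2, hu3⟩ v ⟨hv1, hv2, hv3⟩ a b ha hb hab
  have e : (a • u + b • v).snd = a * u.snd + b * v.snd := by simp
  refine ⟨?_, ?_, ?_⟩
  · rw [e]; nlinarith
  · rw [e]; nlinarith
  · rw [e, WithLp.add_fst, WithLp.smul_fst, WithLp.smul_fst]
    rw [le_div_iff₀ (heps i)] at hu3 hv3 ⊢
    have h1 := norm_add_le (a • u.fst) (b • v.fst)
    rw [norm_smul, norm_smul, Real.norm_eq_abs, Real.norm_eq_abs, abs_of_nonneg ha,
      abs_of_nonneg hb] at h1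
    calc ‖a • u.fst + b • v.fst‖ * D.eps i
        ≤ (a * ‖u.fst‖ + b * ‖v.fst‖) * D.eps i := by gcongr; exact (heps i).le
      _ = a * (‖u.fst‖ * D.eps i) + b * (‖v.fst‖ * D.eps i) := by ring
      _ ≤ a * -u.snd + b * -v.snd := by gcongr
      _ = -(a * u.snd + b * v.snd) := by ring

theorem norm_le_of_mem_Omega (heps : ∀ i, 0 < D.eps i) {i : Fin m} {o : Lift (P.d i)}
    (ho : o ∈ P.Omega D i) : ‖o‖ ≤ D.mu i * (1 + 1 / D.eps i) := by
  obtain ⟨h1, h2, h3⟩ := ho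
  have h4 := norm_le_norm_fst_add_norm_snd o
  rw [Real.norm_eq_abs, abs_of_nonpos h2] at h4
  have h5 : -o.snd / D.eps i ≤ D.mu i / D.eps i :=
    div_le_div_of_nonneg_right (by linarith) (heps i).le
  have h6 : D.mu i * (1 + 1 / D.eps i) = D.mu i + D.mu i / D.eps i := by ring
  linarith

/-! ### Convexity of the domains -/

theorem convex_primalDomain (hm : P.IsConvexModel) (heps : ∀ i, 0 < D.eps i) :
    Convex ℝ (P.primalDomain D) := by
  rintro u ⟨hu1, hu2⟩ v ⟨hv1, hv2⟩ a b ha hb hab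
  exact ⟨hm.convex_X hu1 hv1 ha hb hab,
    fun i l => convex_Omega heps i (hu2 i l) (hv2 i l) ha hb hab⟩

theorem convex_blockDomain (hm : P.IsConvexModel) (i : Fin m) : Convex ℝ (P.blockDomain D i) :=
  fun _ hu _ hv _ _ ha hb hab l => convex_U hm i l (hu l) (hv l) ha hb hab

theorem W_eq_closedBall : P.W D = Metric.closedBall 0 (P.radW D) := by
  ext w
  simp [W]

theorem convex_W : Convex ℝ (P.W D) := by
  rw [W_eq_closedBall]
  exact convex_closedBall _ _

theorem convex_dualDomain (hm : P.IsConvexModel) : Convex ℝ (P.dualDomain D) :=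
  fun _ hu _ hv _ _ ha hb hab =>
    ⟨fun i => convex_blockDomain hm i (hu.1 i) (hv.1 i) ha hb hab, convex_W hu.2 hv.2 ha hb hab⟩

/-! ### Convexity of the expanded Lagrangian -/

theorem convexOn_persp (hm : P.IsConvexModel) (h0 : ∀ i l, 0 ∈ P.Z i l) {i : Fin m}
    {u : Lift (P.d i)} (hu : u ∈ P.U D i (P.top i)) :
    ConvexOn ℝ P.X fun x => P.persp i x u := by
  have h := (mem_U_iff (h0 i _)).1 hu
  exact (hm.convexOn_g i _ h.2.2.1).smul h.1

/-- This is the perspective argument: `unlift` of a combination is the average of the two unlifted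
points, weighted by their scalars. If these weights vanish, both sides are 0. -/
theorem concaveOn_persp (hm : P.IsConvexModel) (h0 : ∀ i l, 0 ∈ P.Z i l) (i : Fin m)
    {x : Euc n} (hx : x ∈ P.X) : ConcaveOn ℝ (P.U D i (P.top i)) (P.persp i x) := by
  refine ⟨convex_U hm i _, fun u hu v hv a b ha hb hab => ?_⟩
  obtain ⟨hu1, -, hu3, hu4⟩ := (mem_U_iff (h0 i _)).1 hu
  obtain ⟨hv1, -, hv3, hv4⟩ := (mem_U_iff (h0 i _)).1 hv
  have e : (a • u + b • v).snd = a * u.snd + b * v.snd := by simp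
  have hp : 0 ≤ a * u.snd := by positivity
  have hq : 0 ≤ b * v.snd := by positivity
  simp only [persp, smul_eq_mul, e, ← mul_assoc]
  rcases (add_nonneg hp hq).eq_or_lt with h | h
  · have hp0 : a * u.snd = 0 := by linarith
    have hq0 : b * v.snd = 0 := by linarith
    simp [hp0, hq0]
  · have h1 := (hm.concaveOn_g i x hx).2 hu3 hv3 (div_nonneg hp h.le) (div_nonneg hq h.le)
        (by rw [← add_div, div_self h.ne'])
    have h2 : unlift (a • u + b • v) = (a * u.snd / (a * u.snd + b * v.snd)) • unlift u +
        (b * v.snd / (a * u.snd + b * v.snd)) • unlift v := by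
      conv_lhs => rw [unlift, e, WithLp.add_fst, WithLp.smul_fst, WithLp.smul_fst, hu4, hv4]
      rw [smul_add, smul_smul, smul_smul, smul_smul, smul_smul, div_eq_inv_mul, div_eq_inv_mul,
        mul_assoc, mul_assoc]
    rw [h2]
    have h3 := mul_le_mul_of_nonneg_left h1 h.le
    refine le_trans (le_of_eq ?_) h3
    simp only [smul_eq_mul]
    field_simp

theorem convexOn_expLagr (hm : P.IsConvexModel) (heps : ∀ i, 0 < D.eps i)
    (h0 : ∀ i l, 0 ∈ P.Z i l) {y : P.Dual} (hy : y ∈ P.dualDomain D) :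
    ConvexOn ℝ (P.primalDomain D) fun χ => P.expLagr χ y := by
  refine ⟨convex_primalDomain hm heps, fun χ hχ χ' hχ' a b ha hb hab => ?_⟩
  have h1 : ∑ i, P.persp i (a • χ + b • χ').fst (y.1 i (P.top i)) ≤
      a * ∑ i, P.persp i χ.fst (y.1 i (P.top i)) + b * ∑ i, P.persp i χ'.fst (y.1 i (P.top i)) := by
    rw [Finset.mul_sum, Finset.mul_sum, ← Finset.sum_add_distrib]
    exact Finset.sum_le_sum fun i _ =>
      (convexOn_persp hm h0 (hy.1 i (P.top i))).2 hχ.1 hχ'.1 ha hb hab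
  have h2 : P.A (a • χ + b • χ').fst - P.b = a • (P.A χ.fst - P.b) + b • (P.A χ'.fst - P.b) := by
    have : P.b = a • P.b + b • P.b := by rw [← add_smul, hab, one_smul]
    conv_lhs => rw [this]
    simp only [WithLp.add_fst, WithLp.smul_fst, map_add, map_smul, smul_sub]
    abel
  have h3 : ∑ i, ∑ l : Fin (P.t i), inner ℝ ((a • χ + b • χ').snd i l)
        (y.1 i l.castSucc - y.1 i (P.top i)) =
      a * ∑ i, ∑ l : Fin (P.t i), inner ℝ (χ.snd i l) (y.1 i l.castSucc - y.1 i (P.top i)) +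
      b * ∑ i, ∑ l : Fin (P.t i), inner ℝ (χ'.snd i l) (y.1 i l.castSucc - y.1 i (P.top i)) := by
    simp only [Finset.mul_sum, ← Finset.sum_add_distrib]
    refine Finset.sum_congr rfl fun i _ => Finset.sum_congr rfl fun l _ => ?_
    rw [← real_inner_smul_left, ← real_inner_smul_left, ← inner_add_left]
    rfl
  simp only [expLagr, smul_eq_mul]
  rw [h2, h3, WithLp.add_fst, WithLp.smul_fst, WithLp.smul_fst, inner_add_right, inner_add_right,
    real_inner_smul_right, real_inner_smul_right, real_inner_smul_right, real_inner_smul_right]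
  rw [WithLp.add_fst, WithLp.smul_fst, WithLp.smul_fst] at h1
  linarith

theorem concaveOn_expLagr (hm : P.IsConvexModel) (h0 : ∀ i l, 0 ∈ P.Z i l) {χ : P.Primal}
    (hχ : χ ∈ P.primalDomain D) : ConcaveOn ℝ (P.dualDomain D) (P.expLagr χ) := by
  refine ⟨convex_dualDomain hm, fun y hy y' hy' a b ha hb hab => ?_⟩
  have h1 : a * ∑ i, P.persp i χ.fst (y.1 i (P.top i)) +
      b * ∑ i, P.persp i χ.fst (y'.1 i (P.top i)) ≤
      ∑ i, P.persp i χ.fst ((a • y + b • y').1 i (P.top i)) := by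
    rw [Finset.mul_sum, Finset.mul_sum, ← Finset.sum_add_distrib]
    exact Finset.sum_le_sum fun i _ =>
      (concaveOn_persp hm h0 i hχ.1).2 (hy.1 i (P.top i)) (hy'.1 i (P.top i)) ha hb hab
  have h3 : ∑ i, ∑ l : Fin (P.t i), inner ℝ (χ.snd i l)
        ((a • y + b • y').1 i l.castSucc - (a • y + b • y').1 i (P.top i)) =
      a * ∑ i, ∑ l : Fin (P.t i), inner ℝ (χ.snd i l) (y.1 i l.castSucc - y.1 i (P.top i)) +
      b * ∑ i, ∑ l : Fin (P.t i), inner ℝ (χ.snd i l) (y'.1 i l.castSucc - y'.1 i (P.top i)) := by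
    simp only [Finset.mul_sum, ← Finset.sum_add_distrib]
    refine Finset.sum_congr rfl fun i _ => Finset.sum_congr rfl fun l _ => ?_
    rw [← real_inner_smul_right, ← real_inner_smul_right, ← inner_add_right]
    congr 1
    simp only [Prod.fst_add, Prod.smul_fst, Pi.add_apply, Pi.smul_apply, PiLp.add_apply,
      PiLp.smul_apply, smul_sub]
    abel
  simp only [expLagr, smul_eq_mul]
  rw [h3, Prod.snd_add, Prod.smul_snd, Prod.smul_snd, inner_add_left, real_inner_smul_left,
    real_inner_smul_left]
  have h4 : (inner ℝ P.c χ.fst : ℝ) = a * inner ℝ P.c χ.fst + b * inner ℝ P.c χ.fst := by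
    rw [← add_mul, hab, one_mul]
  linarith

/-! ### Subgradient inequalities for the expanded Lagrangian -/

theorem expLagr_sub_le_inner_gradPrimal (h0 : ∀ i l, 0 ∈ P.Z i l) {χ χ' : P.Primal}
    (hχ' : χ' ∈ P.primalDomain D) {y : P.Dual} (hy : y ∈ P.dualDomain D) {dx : Fin m → Euc n}
    (hdx : ∀ i, dx i ∈ subdiff P.X (fun x => P.g i x (unlift (y.1 i (P.top i)))) χ.fst) :
    P.expLagr χ y - P.expLagr χ' y ≤ inner ℝ (P.gradPrimal y dx) (χ - χ') := by
  have h1 : ∑ i, P.persp i χ.fst (y.1 i (P.top i)) - ∑ i, P.persp i χ'.fst (y.1 i (P.top i)) ≤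
      ∑ i, (y.1 i (P.top i)).snd * inner ℝ (dx i) (χ.fst - χ'.fst) := by
    rw [← Finset.sum_sub_distrib]
    refine Finset.sum_le_sum fun i _ => ?_
    have h := hdx i χ'.fst hχ'.1
    have hl := ((mem_U_iff (h0 i _)).1 (hy.1 i (P.top i))).1
    rw [persp, persp, ← mul_sub]
    refine mul_le_mul_of_nonneg_left ?_ hl
    rw [← neg_sub χ'.fst, inner_neg_right]
    linarith
  have h2 : (inner ℝ (P.gradPrimal y dx) (χ - χ') : ℝ) =
      inner ℝ P.c (χ.fst - χ'.fst) + inner ℝ y.2 (P.A (χ.fst - χ'.fst)) +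
      ∑ i, (y.1 i (P.top i)).snd * inner ℝ (dx i) (χ.fst - χ'.fst) +
      ∑ i, ∑ l : Fin (P.t i),
        inner ℝ (χ.snd i l - χ'.snd i l) (y.1 i l.castSucc - y.1 i (P.top i)) := by
    have e : (inner ℝ (P.gradPrimal y dx) (χ - χ') : ℝ) =
        inner ℝ (P.c + ContinuousLinearMap.adjoint P.A y.2 + ∑ i, (y.1 i (P.top i)).snd • dx i)
          (χ.fst - χ'.fst) +
        ∑ i, ∑ l : Fin (P.t i),
          inner ℝ (y.1 i l.castSucc - y.1 i (P.top i)) (χ.snd i l - χ'.snd i l) := by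
      rw [WithLp.prod_inner_apply]
      congr 1
    rw [e]
    simp only [inner_add_left, sum_inner, real_inner_smul_left,
      ContinuousLinearMap.adjoint_inner_left]
    congr 1
    exact Finset.sum_congr rfl fun i _ => Finset.sum_congr rfl fun l _ => real_inner_comm _ _
  have h3 : ∑ i, ∑ l : Fin (P.t i),
        inner ℝ (χ.snd i l - χ'.snd i l) (y.1 i l.castSucc - y.1 i (P.top i)) =
      ∑ i, ∑ l : Fin (P.t i), inner ℝ (χ.snd i l) (y.1 i l.castSucc - y.1 i (P.top i)) -
      ∑ i, ∑ l : Fin (P.t i), inner ℝ (χ'.snd i l) (y.1 i l.castSucc - y.1 i (P.top i)) := by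
    simp only [inner_sub_left, Finset.sum_sub_distrib]
  rw [h2, h3, map_sub, inner_sub_right, inner_sub_right]
  simp only [expLagr, inner_sub_right (y.2) _ P.b]
  linarith

theorem inner_gradBlock (χ : P.Primal) (y : P.Dual) (i : Fin m) (dz : Euc (P.d i))
    (v : P.Block i) :
    (inner ℝ (P.gradBlock χ y i dz) v : ℝ) =
      inner ℝ dz (v (P.top i)).fst + (v (P.top i)).snd *
        (-P.g i χ.fst (unlift (y.1 i (P.top i))) - inner ℝ (unlift (y.1 i (P.top i))) dz) -
      ∑ l : Fin (P.t i), inner ℝ (χ.snd i l) (v l.castSucc - v (P.top i)) := by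
  rw [PiLp.inner_apply, Fin.sum_univ_castSucc]
  simp only [gradBlock, Fin.snoc_castSucc, Fin.snoc_last, inner_add_left, inner_neg_left,
    sum_inner, inner_sub_right, Finset.sum_neg_distrib, Finset.sum_sub_distrib]
  rw [WithLp.prod_inner_apply]
  simp only [WithLp.ofLp_fst, WithLp.ofLp_snd, RCLike.inner_apply, conj_trivial]
  ring

/-- Multiplying the subgradient inequality for -g_i at z' by the scalar λ' turns its affine minorant
into a linear function of u' = (λ'z', λ'). At u this linear function equals minus the perspective,
so it is a subgradient there. The remaining terms are linear in y. -/
theorem expLagr_sub_le_inner_gradBlock (h0 : ∀ i l, 0 ∈ P.Z i l) {χ : P.Primal} {y y' : P.Dual}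
    (hy : y ∈ P.dualDomain D) (hy' : y' ∈ P.dualDomain D) {dz : ∀ i, Euc (P.d i)}
    (hdz : ∀ i, dz i ∈ subdiff (P.Z i (P.top i)) (fun z => -P.g i χ.fst z)
      (unlift (y.1 i (P.top i)))) :
    P.expLagr χ y' - P.expLagr χ y ≤
      ∑ i, inner ℝ (P.gradBlock χ y i (dz i)) (y.1 i - y'.1 i) +
        inner ℝ (-(P.A χ.fst - P.b)) (y.2 - y'.2) := by
  have h1 : ∀ i, P.persp i χ.fst (y'.1 i (P.top i)) - P.persp i χ.fst (y.1 i (P.top i)) +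
      ∑ l : Fin (P.t i), inner ℝ (χ.snd i l) (y'.1 i l.castSucc - y'.1 i (P.top i)) -
      ∑ l : Fin (P.t i), inner ℝ (χ.snd i l) (y.1 i l.castSucc - y.1 i (P.top i)) ≤
      inner ℝ (P.gradBlock χ y i (dz i)) (y.1 i - y'.1 i) := by
    intro i
    obtain ⟨-, -, -, h4⟩ := (mem_U_iff (h0 i _)).1 (hy.1 i (P.top i))
    obtain ⟨h1', -, h3', h4'⟩ := (mem_U_iff (h0 i _)).1 (hy'.1 i (P.top i))
    have h := mul_le_mul_of_nonneg_left (hdz i _ h3') h1'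
    rw [inner_gradBlock]
    have e1 : (y.1 i - y'.1 i) (P.top i) = y.1 i (P.top i) - y'.1 i (P.top i) := rfl
    have e2 : ∀ l : Fin (P.t i), (inner ℝ (χ.snd i l)
        ((y.1 i - y'.1 i) l.castSucc - (y.1 i - y'.1 i) (P.top i)) : ℝ) =
        inner ℝ (χ.snd i l) (y.1 i l.castSucc - y.1 i (P.top i)) -
        inner ℝ (χ.snd i l) (y'.1 i l.castSucc - y'.1 i (P.top i)) := by
      intro l
      rw [← inner_sub_right]
      congr 1
      simp only [PiLp.sub_apply]
      abel
    simp only [e2, Finset.sum_sub_distrib]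
    rw [e1, WithLp.sub_fst, WithLp.sub_snd]
    rw [h4, h4', inner_sub_right, real_inner_smul_right, real_inner_smul_right, persp, persp]
    rw [inner_sub_right] at h
    rw [real_inner_comm (dz i) (unlift (y.1 i (P.top i)))]
    linarith
  have h2 := Finset.sum_le_sum fun i (_ : i ∈ Finset.univ) => h1 i
  simp only [Finset.sum_add_distrib, Finset.sum_sub_distrib] at h2
  have h3 : (inner ℝ (-(P.A χ.fst - P.b)) (y.2 - y'.2) : ℝ) =
      inner ℝ y'.2 (P.A χ.fst - P.b) - inner ℝ y.2 (P.A χ.fst - P.b) := by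
    rw [inner_neg_left, inner_sub_right, real_inner_comm y.2, real_inner_comm y'.2]
    ring
  rw [h3]
  simp only [expLagr]
  linarith

/-! ### Bounds on the subgradients -/

theorem norm_gradPrimal_le (hm : P.IsConvexModel) {y : P.Dual} (hy : y ∈ P.dualDomain D)
    {dx : Fin m → Euc n} (hdx : ∀ i, ‖dx i‖ ≤ D.Gx i) :
    ‖P.gradPrimal y dx‖ ≤ P.gPrimal D := by
  have h1 : ‖P.c + ContinuousLinearMap.adjoint P.A y.2 + ∑ i, (y.1 i (P.top i)).snd • dx i‖ ≤
      ‖P.c‖ + ‖P.A‖ * P.radW D + ∑ i, P.lambdaBar D * D.Gx i := by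
    refine (norm_add₃_le).trans (add_le_add (add_le_add le_rfl ?_) ?_)
    · refine (ContinuousLinearMap.le_opNorm _ _).trans ?_
      rw [LinearIsometryEquiv.norm_map]
      exact mul_le_mul_of_nonneg_left hy.2 (norm_nonneg _)
    · refine (norm_sum_le _ _).trans (Finset.sum_le_sum fun i _ => ?_)
      obtain ⟨h1, h2, -⟩ := hy.1 i (P.top i)
      rw [norm_smul, Real.norm_eq_abs, abs_of_nonneg h1]
      exact mul_le_mul h2 (hdx i) (norm_nonneg _) (h1.trans h2)
  have h2 : ‖(P.gradPrimal y dx).snd‖ ≤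
      P.lambdaBar D * ∑ i, ((P.t i : ℝ) * (2 + radius (P.Z i (P.top i)))
        + ∑ l : Fin (P.t i), radius (P.Z i l.castSucc)) := by
    refine (norm_le_sum_norm _).trans ?_
    rw [Finset.mul_sum]
    refine Finset.sum_le_sum fun i _ => (norm_le_sum_norm _).trans ?_
    have h3 : (P.t i : ℝ) * (2 + radius (P.Z i (P.top i))) =
        ∑ _l : Fin (P.t i), (2 + radius (P.Z i (P.top i))) := by
      rw [Finset.sum_const, Finset.card_univ, Fintype.card_fin, nsmul_eq_mul]
    rw [h3, ← Finset.sum_add_distrib, Finset.mul_sum]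
    refine Finset.sum_le_sum fun l _ => ?_
    refine (norm_sub_le (y.1 i l.castSucc) (y.1 i (P.top i))).trans ?_
    have h4 := norm_le_of_mem_U hm (hy.1 i l.castSucc)
    have h5 := norm_le_of_mem_U hm (hy.1 i (P.top i))
    linarith
  exact (norm_le_norm_fst_add_norm_snd _).trans (add_le_add h1 h2)

theorem abs_g_le_gbar (hm : P.IsConvexModel) {i : Fin m} {x : Euc n} (hx : x ∈ P.X)
    {z : Euc (P.d i)} (hz : z ∈ P.Z i (P.top i)) : |P.g i x z| ≤ P.gbar i :=
  le_csSup (hm.bddAbove_g i) ⟨x, hx, z, hz, rfl⟩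

theorem norm_gradBlock_le (hm : P.IsConvexModel) (heps : ∀ i, 0 < D.eps i)
    (h0 : ∀ i l, 0 ∈ P.Z i l) {χ : P.Primal}
    (hχ : χ ∈ P.primalDomain D) {y : P.Dual} (hy : y ∈ P.dualDomain D) {i : Fin m}
    {dz : Euc (P.d i)} (hdz : ‖dz‖ ≤ D.Gz i) : ‖P.gradBlock χ y i dz‖ ≤ P.gBlock D i := by
  set z := unlift (y.1 i (P.top i)) with hz
  have hzm : z ∈ P.Z i (P.top i) := ((mem_U_iff (h0 i _)).1 (hy.1 i (P.top i))).2.2.1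
  have hzr := le_radius (hm.isCompact_Z i _) hzm
  have h1 : ∑ l : Fin (P.t i), ‖χ.snd i l‖ ≤ P.t i * (D.mu i * (1 + 1 / D.eps i)) := by
    refine (Finset.sum_le_sum fun l _ => norm_le_of_mem_Omega heps (hχ.2 i l)).trans_eq ?_
    simp
  have h2 : ‖(WithLp.toLp 2 (dz, -P.g i χ.fst z - inner ℝ z dz) : Lift (P.d i))‖ ≤
      (1 + radius (P.Z i (P.top i))) * D.Gz i + P.gbar i := by
    refine (norm_le_norm_fst_add_norm_snd _).trans ?_
    simp only [WithLp.toLp_fst, WithLp.toLp_snd, Real.norm_eq_abs]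
    have h3 : |-P.g i χ.fst z - inner ℝ z dz| ≤ |P.g i χ.fst z| + |(inner ℝ z dz : ℝ)| := by
      rw [← abs_neg (P.g i χ.fst z)]
      exact abs_sub _ _
    have h4 := abs_g_le_gbar hm hχ.1 hzm
    have h5 := (abs_real_inner_le_norm z dz).trans
      (mul_le_mul hzr hdz (norm_nonneg _) ((norm_nonneg _).trans hzr))
    linarith
  refine (norm_le_sum_norm _).trans ?_
  simp only [gradBlock, Fin.sum_univ_castSucc, Fin.snoc_castSucc, Fin.snoc_last, norm_neg]
  have h6 := (norm_add_le (WithLp.toLp 2 (dz, -P.g i χ.fst z - inner ℝ z dz) : Lift (P.d i))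
    (∑ l : Fin (P.t i), χ.snd i l)).trans (add_le_add h2 ((norm_sum_le _ _).trans h1))
  rw [gBlock]
  linarith

theorem norm_gradW_le (hm : P.IsConvexModel) {x : Euc n} (hx : x ∈ P.X) :
    ‖-(P.A x - P.b)‖ ≤ P.gW := by
  rw [norm_neg, gW]
  refine (norm_sub_le _ _).trans (add_le_add_left ((P.A.le_opNorm x).trans ?_) _)
  exact mul_le_mul_of_nonneg_left (le_radius hm.isCompact_X hx) (norm_nonneg _)

/-! ### The gap of the expanded Lagrangian -/

theorem IsRun.mem_domain {N : ℕ} {χ y dx dz} (h : P.IsRun D N χ y dx dz) :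
    ∀ k ≤ N, χ k ∈ P.primalDomain D ∧ y k ∈ P.dualDomain D
  | 0, _ => ⟨h.init_primal, h.init_dual⟩
  | k + 1, hk => ⟨(h.step_primal k hk).1, fun i => (h.step_block k hk i).1, (h.step_w k hk).1⟩

theorem IsRun.expLagr_gap_le {N : ℕ} {χ y dx dz} (h : P.IsRun D N χ y dx dz) (hN : 1 ≤ N)
    (hm : P.IsConvexModel) (heps : ∀ i, 0 < D.eps i) (h0 : ∀ i l, 0 ∈ P.Z i l)
    (htau : 0 < D.tau) (htheta : ∀ i, 0 < D.theta i) (hthetaW : 0 < D.thetaW)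
    {χ' : P.Primal} (hχ' : χ' ∈ P.primalDomain D) {y' : P.Dual} (hy' : y' ∈ P.dualDomain D) :
    P.expLagr (ergodicMean N χ) y' - P.expLagr χ' (ergodicMean N y) ≤
      1 / (2 * √N) *
        (‖χ 0 - χ'‖ ^ 2 / D.tau + D.tau * P.gPrimal D ^ 2
          + ∑ i, (‖(y 0).1 i - y'.1 i‖ ^ 2 / D.theta i + D.theta i * P.gBlock D i ^ 2)
          + ‖(y 0).2 - y'.2‖ ^ 2 / D.thetaW + D.thetaW * P.gW ^ 2) := by
  have hd : ∀ k < N, χ k ∈ P.primalDomain D ∧ y k ∈ P.dualDomain D :=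
    fun k hk => h.mem_domain k hk.le
  have j1 := (convexOn_expLagr hm heps h0 hy').map_ergodicMean_le hN fun k hk => (hd k hk).1
  have j2 := (concaveOn_expLagr hm h0 hχ').le_map_ergodicMean hN fun k hk => (hd k hk).2
  have r1 := average_inner_le_of_isProj (convex_primalDomain hm heps) hN htau h.step_primal
    (fun k hk => norm_gradPrimal_le hm (hd k hk).2 (h.dx_le k hk)) hχ'
  have r2 := fun i => average_inner_le_of_isProj (p := fun k => (y k).1 i)
    (v := fun k => P.gradBlock (χ k) (y k) i (dz k i)) (convex_blockDomain hm i) hN (htheta i)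
    (fun k hk => h.step_block k hk i)
    (fun k hk => norm_gradBlock_le hm heps h0 (hd k hk).1 (hd k hk).2 (h.dz_le k hk i)) (hy'.1 i)
  -- The ascent step in w is a descent step along -(Ax - b).
  have r3 := average_inner_le_of_isProj (p := fun k => (y k).2)
    (v := fun k => -(P.A (χ k).fst - P.b)) convex_W hN hthetaW
    (fun k hk => by simpa only [smul_neg, sub_neg_eq_add] using h.step_w k hk)
    (fun k hk => norm_gradW_le hm (hd k hk).1.1) hy'.2
  have r2' := Finset.sum_le_sum fun i (_ : i ∈ Finset.univ) => r2 i
  rw [← Finset.mul_sum, ← Finset.mul_sum, Finset.sum_comm] at r2'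
  have key : ∑ k ∈ Finset.range N, (P.expLagr (χ k) y' - P.expLagr χ' (y k)) ≤
      ∑ k ∈ Finset.range N, (inner ℝ (P.gradPrimal (y k) (dx k)) (χ k - χ') +
        ∑ i, inner ℝ (P.gradBlock (χ k) (y k) i (dz k i)) ((y k).1 i - y'.1 i) +
        inner ℝ (-(P.A (χ k).fst - P.b)) ((y k).2 - y'.2)) := by
    refine Finset.sum_le_sum fun k hk => ?_
    have hk := Finset.mem_range.1 hk
    have i1 := expLagr_sub_le_inner_gradPrimal h0 hχ' (hd k hk).2 (h.dx_mem k hk)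
    have i2 := expLagr_sub_le_inner_gradBlock h0 (hd k hk).2 hy' (h.dz_mem k hk)
    linarith
  have key' := mul_le_mul_of_nonneg_left key (inv_nonneg.2 (Nat.cast_nonneg (α := ℝ) N))
  simp only [Finset.sum_add_distrib, Finset.sum_sub_distrib, mul_add, mul_sub] at key' r1 r2' r3 ⊢
  simp only [ergodicMean, smul_eq_mul] at j1 j2 ⊢
  linarith

/-! ### The robust constraint functions -/

theorem bddAbove_image_Zint (hm : P.IsConvexModel) (i : Fin m) {x : Euc n} (hx : x ∈ P.X) :
    BddAbove (P.g i x '' P.Zint i) := by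
  refine ⟨P.gbar i, ?_⟩
  rintro _ ⟨z, hz, rfl⟩
  exact (le_abs_self _).trans (abs_g_le_gbar hm hx (Set.mem_iInter.1 hz _))

theorem g_le_f (hm : P.IsConvexModel) {i : Fin m} {x : Euc n} (hx : x ∈ P.X) {z : Euc (P.d i)}
    (hz : z ∈ P.Zint i) : P.g i x z ≤ P.f i x :=
  le_csSup (bddAbove_image_Zint hm i hx) ⟨z, hz, rfl⟩

theorem exists_f_sub_lt_g {i : Fin m} (h0 : (0 : Euc (P.d i)) ∈ P.Zint i) (x : Euc n) {ε : ℝ}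
    (hε : 0 < ε) : ∃ z ∈ P.Zint i, P.f i x - ε < P.g i x z := by
  have hne : (P.g i x '' P.Zint i).Nonempty := ⟨_, 0, h0, rfl⟩
  obtain ⟨_, ⟨z, hz, rfl⟩, h⟩ := exists_lt_of_lt_csSup hne (sub_lt_self (P.f i x) hε)
  exact ⟨z, hz, h⟩

theorem convexOn_f (hm : P.IsConvexModel) {i : Fin m} (h0 : (0 : Euc (P.d i)) ∈ P.Zint i) :
    ConvexOn ℝ P.X (P.f i) := by
  refine ⟨hm.convex_X, fun x hx x' hx' a b ha hb hab => ?_⟩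
  refine csSup_le ⟨_, 0, h0, rfl⟩ ?_
  rintro _ ⟨z, hz, rfl⟩
  refine ((hm.convexOn_g i z (Set.mem_iInter.1 hz _)).2 hx hx' ha hb hab).trans ?_
  exact add_le_add (mul_le_mul_of_nonneg_left (g_le_f hm hx hz) ha)
    (mul_le_mul_of_nonneg_left (g_le_f hm hx' hz) hb)

/-! ### Multipliers for the intersection of the uncertainty sets -/

theorem apply_eq_sum_single {ι : Type*} [Fintype ι] [DecidableEq ι] {E : Type*}
    [NormedAddCommGroup E] [NormedSpace ℝ E] (p : (ι → E) →L[ℝ] ℝ) (y : ι → E) :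
    p y = ∑ l, p.comp (ContinuousLinearMap.single ℝ (fun _ => E) l) (y l) := by
  conv_lhs => rw [← Finset.univ_sum_single y]
  rw [map_sum]
  rfl

theorem norm_le_div_of_inner_le {V : Type*} [NormedAddCommGroup V] [InnerProductSpace ℝ V]
    {ν : V} {ε a : ℝ} (hε : 0 < ε) (h : ∀ z, ‖z‖ ≤ ε → inner ℝ ν z ≤ a) : ‖ν‖ ≤ a / ε := by
  rw [le_div_iff₀ hε]
  rcases eq_or_ne ν 0 with rfl | hν
  · simpa using h 0 (by simpa using hε.le)
  · have hν' := norm_ne_zero_iff.2 hν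
    have h1 := h ((ε / ‖ν‖) • ν) (by
      rw [norm_smul, Real.norm_eq_abs, abs_of_nonneg (by positivity), div_mul_cancel₀ _ hν'])
    rw [real_inner_smul_right, real_inner_self_eq_norm_sq] at h1
    calc ‖ν‖ * ε = ε / ‖ν‖ * ‖ν‖ ^ 2 := by field_simp
      _ ≤ a := h1

/-- Convex duality for `max {g_i(x, z) : z ∈ ⋂ l, Z^{i,l}} ≤ 0`: the nonpositivity is certified by
functions `z ↦ ⟪ν_l, z⟫ + μ_l` that are maximal at `0` on `Z^{i,l}`. -/
theorem exists_affine_majorant (hm : P.IsConvexModel) {i : Fin m} {ε : ℝ} (hε : 0 < ε)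
    (hball : Metric.closedBall 0 ε ⊆ P.Zint i) {x : Euc n} (hx : x ∈ P.X) (hf : P.f i x ≤ 0) :
    ∃ (ν : Fin (P.t i) → Euc (P.d i)) (μ : Fin (P.t i) → ℝ),
      (∀ l, ∀ z ∈ P.Z i l.castSucc, inner ℝ (ν l) z + μ l ≤ 0) ∧
      ∀ z ∈ P.Z i (P.top i), P.g i x z ≤ ∑ l, (inner ℝ (ν l) z + μ l) := by
  have hZ : ∀ z : Euc (P.d i), ‖z‖ ≤ ε → ∀ l, z ∈ P.Z i l := fun z hz l =>
    Set.mem_iInter.1 (hball (by simpa using hz)) l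
  have hZ0 : ∀ l, 0 ∈ P.Z i l := hZ 0 (by simpa using hε.le)
  -- The hypograph of the value function when the copies may differ from the distinguished one by a
  -- prescribed perturbation.
  let K : Set ((Fin (P.t i) → Euc (P.d i)) × ℝ) :=
    {q | ∃ z : Fin (P.t i) → Euc (P.d i), ∃ z' ∈ P.Z i (P.top i),
      (∀ l, z l ∈ P.Z i l.castSucc) ∧ (q.1 = fun l => z l - z') ∧ q.2 ≤ P.g i x z'}
  have hK : Convex ℝ K := by
    rintro q ⟨z, z', hz', hz, hq1, hq2⟩ q₁ ⟨w, w', hw', hw, hv1, hv2⟩ a b ha hb hab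
    refine ⟨fun l => a • z l + b • w l, a • z' + b • w', hm.convex_Z i _ hz' hw' ha hb hab,
      fun l => hm.convex_Z i _ (hz l) (hw l) ha hb hab, ?_, ?_⟩
    · ext1 l
      simp only [Prod.fst_add, Prod.smul_fst, Pi.add_apply, Pi.smul_apply, hq1, hv1, smul_sub]
      abel
    · refine le_trans ?_ ((hm.concaveOn_g i x hx).2 hz' hw' ha hb hab)
      exact add_le_add (mul_le_mul_of_nonneg_left hq2 ha) (mul_le_mul_of_nonneg_left hv2 hb)
  obtain ⟨p, hp⟩ := exists_le_of_convex_hypograph hK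
    (fun y s s' ⟨z, z', hz', hz, h1, h2⟩ h => ⟨z, z', hz', hz, h1, h.trans h2⟩)
    -- For a perturbation y of norm at most ε, the distinguished copy 0 and the other copies y l are
    -- admissible, since the ball lies in every set.
    (M := P.g i x 0) (by
      filter_upwards [Metric.closedBall_mem_nhds (0 : Fin (P.t i) → Euc (P.d i)) hε] with y hy
      refine ⟨y, 0, hZ0 _, fun l => hZ _ ?_ _, by simp, le_rfl⟩
      exact (norm_le_pi_norm y l).trans (by simpa using hy))
    (by
      -- Zero perturbation makes all copies equal, so z' lies in the intersection and its value is
      -- at most f_i(x) ≤ 0.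
      rintro s ⟨z, z', hz', hz, h1, h2⟩
      refine h2.trans ((g_le_f hm hx (Set.mem_iInter.2 fun l => ?_)).trans hf)
      refine Fin.lastCases hz' (fun l => ?_) l
      have := congrFun h1 l
      rw [← sub_eq_zero.1 this.symm]
      exact hz l)
  let ν : Fin (P.t i) → Euc (P.d i) := fun l =>
    (InnerProductSpace.toDual ℝ (Euc (P.d i))).symm
      (p.comp (ContinuousLinearMap.single ℝ (fun _ => Euc (P.d i)) l))
  have hν : ∀ y, p y = ∑ l, inner ℝ (ν l) (y l) := by
    intro y
    simp only [ν, InnerProductSpace.toDual_symm_apply]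
    exact apply_eq_sum_single p y
  have hmax : ∀ l, ∃ z ∈ P.Z i (Fin.castSucc l), ∀ z' ∈ P.Z i (Fin.castSucc l),
      (inner ℝ (ν l) z' : ℝ) ≤ inner ℝ (ν l) z := fun l =>
    (hm.isCompact_Z i l.castSucc).exists_isMaxOn (f := fun z => (inner ℝ (ν l) z : ℝ)) ⟨0, hZ0 _⟩
      (Continuous.continuousOn (by fun_prop))
  choose zm hzm hmax using hmax
  -- The constant μ_l is minus the support function of Z^{i,l} at ν_l, attained at `zm l` by
  -- compactness.
  refine ⟨ν, fun l => -inner ℝ (ν l) (zm l), fun l z hz => ?_, fun z hz => ?_⟩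
  · have := hmax l z hz
    linarith
  · have h := hp (fun l => zm l - z) (P.g i x z) ⟨zm, z, hz, hzm, rfl, le_rfl⟩
    rw [hν] at h
    simp only [inner_sub_right, Finset.sum_sub_distrib] at h
    rw [Finset.sum_add_distrib, Finset.sum_neg_distrib]
    linarith

/-- The certificates themselves serve as multipliers ω_l = (ν_l, μ_l). All μ_l are nonpositive and
the majorant at 0 gives g_i(x, 0) ≤ ∑ μ_l, whence μ_l ≥ -μ̄_i; maximality over the ball bounds ν_l.
Scaling by the lifted scalars, which may differ between copies, preserves the signs. -/
theorem exists_omega (hm : P.IsConvexModel) {i : Fin m} (heps : 0 < D.eps i)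
    (hball : Metric.closedBall 0 (D.eps i) ⊆ P.Zint i) {x : Euc n} (hx : x ∈ P.X)
    (hf : P.f i x ≤ 0) (hmu : -P.g i x 0 ≤ D.mu i) :
    ∃ ω : Fin (P.t i) → Lift (P.d i), (∀ l, ω l ∈ P.Omega D i) ∧
      ∀ v ∈ P.blockDomain D i, P.persp i x (v (P.top i)) +
        ∑ l : Fin (P.t i), inner ℝ (ω l) (v l.castSucc - v (P.top i)) ≤ 0 := by
  obtain ⟨ν, μ, h1, h2⟩ := exists_affine_majorant hm heps hball hx hf
  have hZ : ∀ z : Euc (P.d i), ‖z‖ ≤ D.eps i → ∀ l, z ∈ P.Z i l := fun z hz l =>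
    Set.mem_iInter.1 (hball (by simpa using hz)) l
  have hZ0 : ∀ l, 0 ∈ P.Z i l := hZ 0 (by simpa using heps.le)
  have hμ : ∀ l, μ l ≤ 0 := fun l => by simpa using h1 l 0 (hZ0 _)
  have hin : ∀ l (u : Lift (P.d i)),
      (inner ℝ (WithLp.toLp 2 (ν l, μ l) : Lift (P.d i)) u : ℝ) =
        inner ℝ (ν l) u.fst + u.snd * μ l := by
    intro l u
    rw [WithLp.prod_inner_apply]
    rfl
  refine ⟨fun l => WithLp.toLp 2 (ν l, μ l), fun l => ⟨?_, hμ l, ?_⟩, fun v hv => ?_⟩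
  · have h3 := h2 0 (hZ0 _)
    simp only [inner_zero_right, zero_add] at h3
    have h4 : ∑ l, μ l ≤ μ l := by
      rw [← Finset.add_sum_erase _ _ (Finset.mem_univ l)]
      linarith [Finset.sum_nonpos fun j (_ : j ∈ Finset.univ.erase l) => hμ j]
    simp only [WithLp.toLp_snd]
    linarith
  · exact norm_le_div_of_inner_le heps fun z hz => by
      have := h1 l z (hZ z hz _)
      change inner ℝ (ν l) z ≤ -μ l
      linarith
  · obtain ⟨a1, -, a3, a4⟩ := (mem_U_iff (hZ0 _)).1 (hv (P.top i))
    have h3 := mul_le_mul_of_nonneg_left (h2 _ a3) a1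
    rw [Finset.mul_sum] at h3
    have h4 : ∑ l : Fin (P.t i), (inner ℝ (WithLp.toLp 2 (ν l, μ l) : Lift (P.d i))
        (v l.castSucc - v (P.top i)) : ℝ) ≤
        ∑ l, -((v (P.top i)).snd * (inner ℝ (ν l) (unlift (v (P.top i))) + μ l)) := by
      refine Finset.sum_le_sum fun l _ => ?_
      obtain ⟨b1, -, b3, b4⟩ := (mem_U_iff (hZ0 _)).1 (hv l.castSucc)
      have h5 := mul_nonpos_of_nonneg_of_nonpos b1 (h1 l _ b3)
      rw [inner_sub_right, hin, hin, a4, b4, real_inner_smul_right, real_inner_smul_right]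
      linarith
    rw [Finset.sum_neg_distrib] at h4
    rw [persp]
    linarith

/-! ### Comparison of the expanded with the original Lagrangian -/

theorem exists_primal_expLagr_le (hm : P.IsConvexModel)
    (hball : ∀ i, 0 < D.eps i ∧ Metric.closedBall 0 (D.eps i) ⊆ P.Zint i)
    (hmu : ∀ i, ∀ x ∈ P.feasible, -P.g i x 0 ≤ D.mu i) {x : Euc n} (hx : x ∈ P.feasible) :
    ∃ χ ∈ P.primalDomain D, χ.fst = x ∧
      ∀ y ∈ P.dualDomain D, P.expLagr χ y ≤ inner ℝ P.c x := by
  choose ω hω h using fun i =>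
    exists_omega hm (hball i).1 (hball i).2 hx.1 (hx.2.1 i) (hmu i x hx)
  refine ⟨WithLp.toLp 2 (x, WithLp.toLp 2 fun i => WithLp.toLp 2 (ω i)), ⟨hx.1, hω⟩, rfl, ?_⟩
  intro y hy
  have h1 := Finset.sum_nonpos fun i (_ : i ∈ Finset.univ) => h i (y.1 i) (hy.1 i)
  rw [Finset.sum_add_distrib] at h1
  have h2 : P.A x - P.b = 0 := sub_eq_zero.2 hx.2.2
  simp only [expLagr, WithLp.toLp_fst, WithLp.toLp_snd, h2, inner_zero_right]
  linarith

/-- The dual variables all of whose copies in block `i` are `(lam i * z i, lam i)`. -/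
def diagDual (P : RobustProblem n r m) (lam : Fin m → ℝ) (z : ∀ i, Euc (P.d i)) (w : Euc r) :
    P.Dual :=
  (fun i => WithLp.toLp 2 fun _ => WithLp.toLp 2 (lam i • z i, lam i), w)

theorem diagDual_mem {lam : Fin m → ℝ} (hlam : ∀ i, 0 ≤ lam i ∧ lam i ≤ P.lambdaBar D)
    {z : ∀ i, Euc (P.d i)} (hz : ∀ i, z i ∈ P.Zint i) {w : Euc r} (hw : w ∈ P.W D) :
    P.diagDual lam z w ∈ P.dualDomain D :=
  ⟨fun i l => ⟨(hlam i).1, (hlam i).2, z i, Set.mem_iInter.1 (hz i) l, rfl⟩, hw⟩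

theorem expLagr_diagDual (χ : P.Primal) (lam : Fin m → ℝ) (z : ∀ i, Euc (P.d i)) (w : Euc r) :
    P.expLagr χ (P.diagDual lam z w) =
      inner ℝ P.c χ.fst + inner ℝ w (P.A χ.fst - P.b) + ∑ i, lam i * P.g i χ.fst (z i) := by
  have h : ∀ i, P.persp i χ.fst ((P.diagDual lam z w).1 i (P.top i)) =
      lam i * P.g i χ.fst (z i) := by
    intro i
    simp only [diagDual, persp, unlift, WithLp.toLp_fst, WithLp.toLp_snd]
    rcases eq_or_ne (lam i) 0 with h | h
    · simp [h]
    · rw [inv_smul_smul₀ h]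
  simp only [expLagr, h]
  simp [diagDual]

/-- Near maximizers suffice, so attainment of the supremum defining f_i plays no role. They depend
on x but not on ω. -/
theorem exists_lagr_le_expLagr (h0 : ∀ i, (0 : Euc (P.d i)) ∈ P.Zint i) (x : Euc n)
    {lam : Fin m → ℝ} (hlam : ∀ i, 0 ≤ lam i) (w : Euc r) {δ : ℝ} (hδ : 0 < δ) :
    ∃ z : ∀ i, Euc (P.d i), (∀ i, z i ∈ P.Zint i) ∧
      ∀ χ : P.Primal, χ.fst = x → P.lagr x lam w ≤ P.expLagr χ (P.diagDual lam z w) + δ := by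
  have hs : 0 ≤ ∑ i, lam i := Finset.sum_nonneg fun i _ => hlam i
  -- Errors are weighted by the multipliers, and the 1 keeps the denominator positive when these all
  -- vanish.
  have hε : 0 < δ / (1 + ∑ i, lam i) := by positivity
  choose z hz h using fun i => exists_f_sub_lt_g (h0 i) x hε
  refine ⟨z, hz, fun χ hχ => ?_⟩
  rw [expLagr_diagDual, hχ, lagr]
  have h1 : ∑ i, lam i * P.f i x ≤
      ∑ i, (lam i * P.g i x (z i) + lam i * (δ / (1 + ∑ i, lam i))) := by
    refine Finset.sum_le_sum fun i _ => ?_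
    rw [← mul_add]
    exact mul_le_mul_of_nonneg_left (by linarith [h i]) (hlam i)
  rw [Finset.sum_add_distrib, ← Finset.sum_mul] at h1
  have h2 : (∑ i, lam i) * (δ / (1 + ∑ i, lam i)) ≤ δ := by
    rw [mul_div_assoc', div_le_iff₀ (by positivity)]
    nlinarith
  linarith

/-! ### Distances of the initial points -/

/-- With M = max λ λ₀, each copy differs by at most 2RM in the vector part and M in the scalar part,
which produces the factor 1 + 4R². The common initial scalar λ₀ makes M the same for all copies. -/
theorem norm_sub_diag_sq_le (hm : P.IsConvexModel) {i : Fin m} {v : P.Block i}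
    (hv : v ∈ P.blockDomain D i) {lam₀ : ℝ} (hv0 : ∀ l, (v l).snd = lam₀) {z : Euc (P.d i)}
    (hz : z ∈ P.Zint i) {lam : ℝ} (hlam : 0 ≤ lam) {v' : P.Block i}
    (hv' : ∀ l, v' l = WithLp.toLp 2 (lam • z, lam)) : ‖v - v'‖ ^ 2 ≤
      P.sigma i * max lam lam₀ ^ 2 := by
  rw [PiLp.norm_sq_eq_of_L2, sigma, Finset.sum_mul]
  refine Finset.sum_le_sum fun l _ => ?_
  rw [WithLp.prod_norm_sq_eq_of_L2]
  obtain ⟨h1, -, z', hz', h⟩ := hv l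
  rw [hv0 l] at h h1
  have hR := le_radius (hm.isCompact_Z i l) hz'
  have hR' := le_radius (hm.isCompact_Z i l) (Set.mem_iInter.1 hz l)
  have hR0 := (norm_nonneg _).trans hR
  have m1 := le_max_left lam lam₀
  have m2 := le_max_right lam lam₀
  have hM : 0 ≤ max lam lam₀ := hlam.trans m1
  have e1 : ‖((v - v') l).fst‖ ≤
      2 * radius (P.Z i l) * max lam lam₀ := by
    have e : ((v - v') l).fst =
      lam₀ • z' - lam • z := by
      rw [PiLp.sub_apply, WithLp.sub_fst, h, hv' l]
      rfl
    rw [e]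
    refine (norm_sub_le _ _).trans ?_
    rw [norm_smul, norm_smul, Real.norm_eq_abs, Real.norm_eq_abs, abs_of_nonneg h1,
      abs_of_nonneg hlam]
    have := mul_le_mul m2 hR (norm_nonneg _) hM
    have := mul_le_mul m1 hR' (norm_nonneg _) hM
    linarith
  have e2 : ‖((v - v') l).snd‖ ≤
      max lam lam₀ := by
    have e : ((v - v') l).snd =
      lam₀ - lam := by
      rw [PiLp.sub_apply, WithLp.sub_snd, hv0 l, hv' l]
      rfl
    rw [e, Real.norm_eq_abs, abs_le]
    constructor <;> linarith
  have s1 := pow_le_pow_left₀ (norm_nonneg _) e1 2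
  have s2 := pow_le_pow_left₀ (norm_nonneg _) e2 2
  linarith

theorem norm_sub_primal_sq_le (heps : ∀ i, 0 < D.eps i) {χ χ' : P.Primal}
    (hχ : χ ∈ P.primalDomain D) (hχ' : χ' ∈ P.primalDomain D) :
    ‖χ - χ'‖ ^ 2 ≤ ‖χ'.fst - χ.fst‖ ^ 2 +
      4 * (∑ i, D.mu i * (P.t i : ℝ) * (1 + 1 / D.eps i)) ^ 2 := by
  have h1 : ‖(χ - χ').snd‖ ≤ 2 * ∑ i, D.mu i * (P.t i : ℝ) * (1 + 1 / D.eps i) := by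
    refine (norm_le_sum_norm _).trans ?_
    rw [Finset.mul_sum]
    refine Finset.sum_le_sum fun i _ => (norm_le_sum_norm _).trans ?_
    have h2 : ∀ l ∈ Finset.univ, ‖((χ - χ').snd i) l‖ ≤ 2 * (D.mu i * (1 + 1 / D.eps i)) := by
      intro l _
      have := norm_sub_le (χ.snd i l) (χ'.snd i l)
      have e1 := norm_le_of_mem_Omega heps (hχ.2 i l)
      have e2 := norm_le_of_mem_Omega heps (hχ'.2 i l)
      exact this.trans (by linarith)
    refine (Finset.sum_le_card_nsmul _ _ _ h2).trans_eq ?_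
    rw [Finset.card_univ, Fintype.card_fin, nsmul_eq_mul]
    ring
  have h2 := pow_le_pow_left₀ (norm_nonneg _) h1 2
  rw [WithLp.prod_norm_sq_eq_of_L2, WithLp.sub_fst, norm_sub_rev]
  linarith

theorem norm_sub_W_sq_le (w w₀ : Euc r) : ‖w₀ - w‖ ^ 2 ≤ 4 * max ‖w‖ ‖w₀‖ ^ 2 := by
  have h : ‖w₀ - w‖ ≤ 2 * max ‖w‖ ‖w₀‖ := by
    linarith [norm_sub_le w₀ w, le_max_left ‖w‖ ‖w₀‖, le_max_right ‖w‖ ‖w₀‖]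
  have := pow_le_pow_left₀ (norm_nonneg _) h 2
  linarith

/-! ### The gap of the original Lagrangian on the bounded dual domain -/

theorem IsRun.fst_ergodicMean_mem {N : ℕ} {χ y dx dz} (h : P.IsRun D N χ y dx dz) (hN : 1 ≤ N)
    (hm : P.IsConvexModel) (heps : ∀ i, 0 < D.eps i) : (ergodicMean N χ).fst ∈ P.X :=
  ((convex_primalDomain hm heps).ergodicMean_mem hN
    fun k hk => (h.mem_domain k hk.le).1).1

theorem IsRun.lagr_gap_le {N : ℕ} {χ y dx dz} (h : P.IsRun D N χ y dx dz) (hN : 1 ≤ N)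
    (hm : P.IsConvexModel)
    (hball : ∀ i, 0 < D.eps i ∧ Metric.closedBall 0 (D.eps i) ⊆ P.Zint i)
    (hmu : ∀ i, ∀ x ∈ P.feasible, -P.g i x 0 ≤ D.mu i)
    (htau : 0 < D.tau) (htheta : ∀ i, 0 < D.theta i) (hthetaW : 0 < D.thetaW)
    {x : Euc n} (hx : x ∈ P.feasible) {lam : Fin m → ℝ}
    (hlam : ∀ i, 0 ≤ lam i ∧ lam i ≤ P.lambdaBar D) {w : Euc r} (hw : w ∈ P.W D) :
    P.lagr (ergodicMean N χ).fst lam w - inner ℝ P.c x ≤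
      1 / (2 * √N) *
        (D.tau⁻¹ * ‖x - (χ 0).fst‖ ^ 2
          + ∑ i, P.sigma i * (D.theta i)⁻¹ * max (lam i) ((y 0).1 i (P.top i)).snd ^ 2
          + 4 * D.thetaW⁻¹ * max ‖w‖ ‖(y 0).2‖ ^ 2 + P.phi D) := by
  have heps := fun i => (hball i).1
  have h0 : ∀ i, (0 : Euc (P.d i)) ∈ P.Zint i := fun i => (hball i).2 (by simpa using (heps i).le)
  have h0' : ∀ i l, 0 ∈ P.Z i l := fun i => Set.mem_iInter.1 (h0 i)
  refine le_of_forall_pos_le_add fun δ hδ => ?_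
  obtain ⟨χ', hχ', hχ'x, hle⟩ := exists_primal_expLagr_le hm hball hmu hx
  obtain ⟨z, hz, hz'⟩ := exists_lagr_le_expLagr h0 (ergodicMean N χ).fst (fun i => (hlam i).1) w hδ
  have hgap := h.expLagr_gap_le hN hm heps h0' htau htheta hthetaW hχ' (diagDual_mem hlam hz hw)
  have j1 := hz' _ rfl
  have j2 := hle _ ((convex_dualDomain hm).ergodicMean_mem hN fun k hk => (h.mem_domain k hk.le).2)
  have d1 := norm_sub_primal_sq_le heps h.init_primal hχ'
  have d2 : ∀ i, ‖(y 0).1 i - (P.diagDual lam z w).1 i‖ ^ 2 ≤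
      P.sigma i * max (lam i) ((y 0).1 i (P.top i)).snd ^ 2 := fun i =>
    norm_sub_diag_sq_le hm (h.init_dual.1 i)
      (fun l => by rw [h.init_lam i l, h.init_lam i (P.top i)]) (hz i) (hlam i).1
      fun _ => rfl
  have d3 := norm_sub_W_sq_le w (y 0).2
  rw [hχ'x] at d1
  have hN' : 0 ≤ 1 / (2 * √(N : ℝ)) := by positivity
  have hB : ‖χ 0 - χ'‖ ^ 2 / D.tau + D.tau * P.gPrimal D ^ 2
      + ∑ i, (‖(y 0).1 i - (P.diagDual lam z w).1 i‖ ^ 2 / D.theta i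
        + D.theta i * P.gBlock D i ^ 2)
      + ‖(y 0).2 - (P.diagDual lam z w).2‖ ^ 2 / D.thetaW + D.thetaW * P.gW ^ 2 ≤
      D.tau⁻¹ * ‖x - (χ 0).fst‖ ^ 2
        + ∑ i, P.sigma i * (D.theta i)⁻¹ * max (lam i) ((y 0).1 i (P.top i)).snd ^ 2
        + 4 * D.thetaW⁻¹ * max ‖w‖ ‖(y 0).2‖ ^ 2 + P.phi D := by
    have e1 := div_le_div_of_nonneg_right d1 htau.le
    have e2 : ∑ i, ‖(y 0).1 i - (P.diagDual lam z w).1 i‖ ^ 2 / D.theta i ≤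
        ∑ i, P.sigma i * (D.theta i)⁻¹ * max (lam i) ((y 0).1 i (P.top i)).snd ^ 2 := by
      refine Finset.sum_le_sum fun i _ => ?_
      refine (div_le_div_of_nonneg_right (d2 i) (htheta i).le).trans_eq ?_
      ring
    have e3 : ‖(y 0).2 - (P.diagDual lam z w).2‖ ^ 2 / D.thetaW ≤
        4 * D.thetaW⁻¹ * max ‖w‖ ‖(y 0).2‖ ^ 2 := by
      refine (div_le_div_of_nonneg_right d3 hthetaW.le).trans_eq ?_
      ring
    rw [add_div, div_eq_inv_mul (‖x - _‖ ^ 2)] at e1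
    rw [Finset.sum_add_distrib, phi]
    linarith
  have := mul_le_mul_of_nonneg_left hB hN'
  linarith

/-! ### Strong duality -/

/-- The point xhat + y is the midpoint of xhat and xhat + 2y, and f_i is negative at the latter.
Convexity thus gives a uniform margin on the half ball without a continuity argument. -/
theorem f_le_half_of_isSlater (hm : P.IsConvexModel)
    (h0 : ∀ i, (0 : Euc (P.d i)) ∈ P.Zint i) {xhat : Euc n} {ε : ℝ} (hs : P.IsSlater xhat ε)
    {y : Euc n} (hy : ‖y‖ ≤ ε / 2) (i : Fin m) : P.f i (xhat + y) ≤ P.f i xhat / 2 := by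
  obtain ⟨h1, -, -, h2⟩ := hs
  have h3 := h2 ((2 : ℝ) • y) (by rw [norm_smul, Real.norm_eq_abs, abs_two]; linarith)
  have h4 := (convexOn_f hm (h0 i)).2 (interior_subset h1) h3.1
    (show (0 : ℝ) ≤ 1 / 2 by norm_num) (show (0 : ℝ) ≤ 1 / 2 by norm_num) (by norm_num)
  have e : (1 / 2 : ℝ) • xhat + (1 / 2 : ℝ) • (xhat + (2 : ℝ) • y) = xhat + y := by module
  rw [e, smul_eq_mul, smul_eq_mul] at h4
  linarith [h3.2 i]

/-- Slater's condition gives Lagrange multipliers. -/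
theorem exists_lagrange_multipliers (hm : P.IsConvexModel)
    (h0 : ∀ i, (0 : Euc (P.d i)) ∈ P.Zint i) {xhat : Euc n} {ε : ℝ} (hs : P.IsSlater xhat ε)
    (hA : Function.Surjective P.A) {xs : Euc n} (hxs : P.IsOptimal xs) :
    ∃ (lam : Fin m → ℝ) (w : Euc r), (∀ i, 0 ≤ lam i) ∧
      ∀ x ∈ P.X, inner ℝ P.c xs ≤ P.lagr x lam w := by
  have hXhat : xhat ∈ P.X := interior_subset hs.1
  have hfhat : ∀ i, P.f i xhat < 0 := fun i => by
    simpa using (hs.2.2.2 0 (by simpa using hs.2.2.1.le)).2 i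
  -- Points of K record a residual of the equalities, upper bounds for the constraints, and an
  -- improvement over the optimal value.
  let K : Set ((Euc r × (Fin m → ℝ)) × ℝ) :=
    {q | ∃ x ∈ P.X, P.A x - P.b = q.1.1 ∧ (∀ i, P.f i x ≤ q.1.2 i) ∧
      q.2 ≤ inner ℝ P.c xs - inner ℝ P.c x}
  have hK : Convex ℝ K := by
    rintro q ⟨x, hx, h1, h2, h3⟩ q' ⟨x', hx', h1', h2', h3'⟩ a b ha hb hab
    refine ⟨a • x + b • x', hm.convex_X hx hx' ha hb hab, ?_, fun i => ?_, ?_⟩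
    · have e : P.b = a • P.b + b • P.b := by rw [← add_smul, hab, one_smul]
      simp only [Prod.fst_add, Prod.smul_fst, ← h1, ← h1', map_add, map_smul, smul_sub]
      conv_lhs => rw [e]
      abel
    · refine ((convexOn_f hm (h0 i)).2 hx hx' ha hb hab).trans ?_
      exact add_le_add (mul_le_mul_of_nonneg_left (h2 i) ha) (mul_le_mul_of_nonneg_left (h2' i) hb)
    · have e : (inner ℝ P.c xs : ℝ) = a * inner ℝ P.c xs + b * inner ℝ P.c xs := by
        rw [← add_mul, hab, one_mul]
      have i1 := mul_le_mul_of_nonneg_left h3 ha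
      have i2 := mul_le_mul_of_nonneg_left h3' hb
      simp only [Prod.snd_add, Prod.smul_snd, smul_eq_mul, inner_add_right, real_inner_smul_right]
      linarith
  -- A linear right inverse realizes each small residual v by the nearby point xhat + B v, where the
  -- constraints keep half their Slater margin.
  obtain ⟨B, hB⟩ := (P.A : Euc n →ₗ[ℝ] Euc r).exists_rightInverse_of_surjective
    (LinearMap.range_eq_top.2 hA)
  have hAB : ∀ v, P.A (B v) = v := fun v => LinearMap.congr_fun hB v
  have hBc : Continuous B := B.continuous_of_finiteDimensional
  obtain ⟨p, hp⟩ := exists_le_of_convex_hypograph hK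
    (fun y s s' ⟨x, hx, h1, h2, h3⟩ h => ⟨x, hx, h1, h2, h.trans h3⟩)
    (M := inner ℝ P.c xs - inner ℝ P.c xhat - ‖P.c‖ * ε) (by
      have e1 : ∀ᶠ q in 𝓝 (0 : Euc r × (Fin m → ℝ)), ‖B q.1‖ < ε / 2 := by
        have : Continuous fun q : Euc r × (Fin m → ℝ) => ‖B q.1‖ := by fun_prop
        refine this.continuousAt.eventually_lt continuousAt_const ?_
        simpa using hs.2.2.1
      have e2 : ∀ᶠ q in 𝓝 (0 : Euc r × (Fin m → ℝ)), ∀ i, P.f i xhat / 2 < q.2 i := by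
        refine eventually_all.2 fun i => ?_
        have : Continuous fun q : Euc r × (Fin m → ℝ) => q.2 i := by fun_prop
        refine continuousAt_const.eventually_lt this.continuousAt ?_
        have := hfhat i
        simp only [Prod.snd_zero, Pi.zero_apply]
        linarith
      filter_upwards [e1, e2] with q hq1 hq2
      refine ⟨xhat + B q.1, (hs.2.2.2 _ (by linarith [hs.2.2.1])).1, ?_, fun i => ?_, ?_⟩
      · rw [map_add, hs.2.1, hAB]
        abel
      · exact (f_le_half_of_isSlater hm h0 hs hq1.le i).trans (hq2 i).le
      · have i1 := real_inner_le_norm P.c (B q.1)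
        have i2 := mul_le_mul_of_nonneg_left (show ‖B q.1‖ ≤ ε by linarith [hs.2.2.1])
          (norm_nonneg P.c)
        rw [inner_add_right]
        linarith)
    (by
      rintro s ⟨x, hx, h1, h2, h3⟩
      have := hxs.2 x ⟨hx, h2, sub_eq_zero.1 h1⟩
      linarith)
  let w := (InnerProductSpace.toDual ℝ (Euc r)).symm
    (p.comp (ContinuousLinearMap.inl ℝ (Euc r) (Fin m → ℝ)))
  let q := p.comp (ContinuousLinearMap.inr ℝ (Euc r) (Fin m → ℝ))
  have hpw : ∀ v u, p (v, u) = inner ℝ w v + ∑ i, u i * q (Pi.single i 1) := by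
    intro v u
    have e1 : p (v, u) = p (v, 0) + q u := by
      change p (v, u) = p (v, 0) + p (0, u)
      rw [← map_add]
      simp
    rw [e1]
    congr 1
    · simp only [w, InnerProductSpace.toDual_symm_apply]
      rfl
    · conv_lhs => rw [← Finset.univ_sum_single u, map_sum]
      refine Finset.sum_congr rfl fun i _ => ?_
      rw [← smul_eq_mul, ← map_smul, ← Pi.single_smul, smul_eq_mul, mul_one]
  have hq : ∀ i, q (Pi.single i 1) ≤ 0 := by
    intro i
    by_contra! hpos
    set s : ℝ := inner ℝ P.c xs - inner ℝ P.c xhat with hs'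
    -- Constraint i may be given arbitrary slack at the Slater point. This amount of slack would
    -- turn the separation inequality into s + |s| + 1 ≤ 0.
    have hT : 0 ≤ (|s| + 1) / q (Pi.single i 1) := by positivity
    have h := hp (0, Pi.single i ((|s| + 1) / q (Pi.single i 1))) s
      ⟨xhat, hXhat, sub_eq_zero.2 hs.2.1, fun j => (hfhat j).le.trans ?_, le_rfl⟩
    · rw [hpw, inner_zero_right, zero_add, Finset.sum_eq_single i
        (fun j _ hj => by rw [Pi.single_eq_of_ne hj, zero_mul])
        (fun h => absurd (Finset.mem_univ i) h), Pi.single_eq_same,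
        div_mul_cancel₀ _ hpos.ne'] at h
      linarith [neg_abs_le s]
    · change 0 ≤ (Pi.single i _ : Fin m → ℝ) j
      rcases eq_or_ne j i with rfl | hj
      · rwa [Pi.single_eq_same]
      · rw [Pi.single_eq_of_ne hj]
  refine ⟨fun i => -q (Pi.single i 1), -w, fun i => neg_nonneg.2 (hq i), fun x hx => ?_⟩
  have h := hp (P.A x - P.b, fun i => P.f i x) _ ⟨x, hx, rfl, fun i => le_rfl, le_rfl⟩
  rw [hpw] at h
  have e : ∑ i, -q (Pi.single i 1) * P.f i x = -∑ i, P.f i x * q (Pi.single i 1) := by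
    rw [← Finset.sum_neg_distrib]
    exact Finset.sum_congr rfl fun i _ => by ring
  rw [lagr, inner_neg_left, e]
  linarith

/-- The Slater multipliers already have dual value at least cᵀx*, and a dual optimum does no worse.
-/
theorem IsDualOptimal.le_lagr (hm : P.IsConvexModel)
    (h0 : ∀ i, (0 : Euc (P.d i)) ∈ P.Zint i) {xhat : Euc n} {ε : ℝ} (hs : P.IsSlater xhat ε)
    (hA : Function.Surjective P.A) {xs : Euc n} (hxs : P.IsOptimal xs) {lams : Fin m → ℝ}
    {ws : Euc r} (h : P.IsDualOptimal lams ws) :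
    ∀ x ∈ P.X, inner ℝ P.c xs ≤ P.lagr x lams ws := by
  obtain ⟨lam, w, hlam, hle⟩ := exists_lagrange_multipliers hm h0 hs hA hxs
  intro x hx
  have h1 : ((inner ℝ P.c xs : ℝ) : EReal) ≤ P.dualFn lam w :=
    le_iInf₂ fun x hx => EReal.coe_le_coe_iff.2 (hle x hx)
  exact EReal.coe_le_coe_iff.1 ((h1.trans (h.2 lam w hlam)).trans (iInf₂_le x hx))

theorem lagr_le_of_mem_feasible {x : Euc n} (hx : x ∈ P.feasible) {lam : Fin m → ℝ}
    (hlam : ∀ i, 0 ≤ lam i) (w : Euc r) : P.lagr x lam w ≤ inner ℝ P.c x := by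
  have h1 := Finset.sum_nonpos fun i (_ : i ∈ Finset.univ) =>
    mul_nonpos_of_nonneg_of_nonpos (hlam i) (hx.2.1 i)
  rw [lagr, sub_eq_zero.2 hx.2.2, inner_zero_right]
  linarith

theorem lagr_add_single (x : Euc n) (lam : Fin m → ℝ) (i : Fin m) (δ : ℝ) (w : Euc r) :
    P.lagr x (lam + Pi.single i δ) w = P.lagr x lam w + δ * P.f i x := by
  have : ∑ j, (lam + Pi.single i δ : Fin m → ℝ) j * P.f j x = ∑ j, lam j * P.f j x + δ * P.f i x := by
    simp only [Pi.add_apply, add_mul, Finset.sum_add_distrib]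
    congr 1
    rw [Finset.sum_eq_single i (fun j _ hj => by rw [Pi.single_eq_of_ne hj, zero_mul])
      (fun h => absurd (Finset.mem_univ i) h), Pi.single_eq_same]
  rw [lagr, lagr, this]
  ring

theorem lagr_add_right (x : Euc n) (lam : Fin m → ℝ) (w v : Euc r) :
    P.lagr x lam (w + v) = P.lagr x lam w + inner ℝ (P.A x - P.b) v := by
  rw [lagr, lagr, inner_add_left, real_inner_comm v]
  ring

/-- Testing maximality at w + (Ax - b) forces Ax = b, at λ + e_i forces f_i(x) ≤ 0, and at λ = 0
gives complementarity, that is, the value cᵀx. -/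
theorem IsSaddle.isOptimal {xs : Euc n} {lams : Fin m → ℝ} {ws : Euc r}
    (h : P.IsSaddle xs lams ws) : P.IsOptimal xs ∧ P.lagr xs lams ws = inner ℝ P.c xs := by
  obtain ⟨hx, hlam, hmax, hmin⟩ := h
  have hA : P.A xs = P.b := by
    have := hmax lams (ws + (P.A xs - P.b)) hlam
    rw [lagr_add_right, real_inner_self_eq_norm_sq] at this
    rw [← sub_eq_zero, ← norm_eq_zero]
    nlinarith [norm_nonneg (P.A xs - P.b)]
  have hf : ∀ i, P.f i xs ≤ 0 := by
    intro i
    have h1 : (0 : Fin m → ℝ) ≤ Pi.single i 1 := Pi.single_nonneg.2 zero_le_one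
    have := hmax (lams + Pi.single i 1) ws fun j => add_nonneg (hlam j) (h1 j)
    rw [lagr_add_single] at this
    linarith
  have hfeas : xs ∈ P.feasible := ⟨hx, hf, hA⟩
  have heq : P.lagr xs lams ws = inner ℝ P.c xs := by
    refine le_antisymm (lagr_le_of_mem_feasible hfeas hlam ws) ?_
    have := hmax 0 ws fun i => le_rfl
    simpa [lagr, hA] using this
  refine ⟨⟨hfeas, fun x' hx' => ?_⟩, heq⟩
  rw [← heq]
  exact (hmin x' hx'.1).trans (lagr_le_of_mem_feasible hx' hlam ws)

/-! ### Bounds on the multipliers -/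

theorem mul_iInf_le_of_le_lagr (hs : P.IsSlater D.xhat D.epsHat) {v : ℝ} {lam : Fin m → ℝ}
    {w : Euc r} (hlam : ∀ i, 0 ≤ lam i) (h : ∀ x ∈ P.X, v ≤ P.lagr x lam w) (i : Fin m) :
    lam i * ⨅ i, -P.f i D.xhat ≤ inner ℝ P.c D.xhat - v := by
  obtain ⟨h1, h2, h3, h4⟩ := hs
  have hf : ∀ i, P.f i D.xhat < 0 := fun i => by
    simpa using (h4 0 (by simpa using h3.le)).2 i
  have h5 := h _ (interior_subset h1)
  rw [lagr, h2, sub_self, inner_zero_right, ← Finset.add_sum_erase _ _ (Finset.mem_univ i)] at h5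
  have h6 := Finset.sum_nonpos fun j (_ : j ∈ Finset.univ.erase i) =>
    mul_nonpos_of_nonneg_of_nonpos (hlam j) (hf j).le
  have h7 : ⨅ i, -P.f i D.xhat ≤ -P.f i D.xhat := ciInf_le (Set.finite_range _).bddBelow i
  have h8 := mul_le_mul_of_nonneg_left h7 (hlam i)
  linarith

/-- On the Slater ball the constraint terms are nonpositive, so evaluating at xhat + y bounds -(c +
Aᵀw)·y by cᵀxhat - v for all ‖y‖ ≤ ε̂. This bounds ‖c + Aᵀw‖, hence ‖Aᵀw‖. -/
theorem sigmaMin_mul_norm_le_of_le_lagr (hs : P.IsSlater D.xhat D.epsHat) {v : ℝ}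
    {lam : Fin m → ℝ} {w : Euc r} (hlam : ∀ i, 0 ≤ lam i)
    (h : ∀ x ∈ P.X, v ≤ P.lagr x lam w) :
    P.sigmaMin * ‖w‖ ≤ (inner ℝ P.c D.xhat - v) / D.epsHat + ‖P.c‖ := by
  obtain ⟨h1, h2, h3, h4⟩ := hs
  set T := LinearMap.adjoint (P.A : Euc n →ₗ[ℝ] Euc r) with hT
  have h5 : ‖-(P.c + T w)‖ ≤ (inner ℝ P.c D.xhat - v) / D.epsHat := by
    refine norm_le_div_of_inner_le h3 fun y hy => ?_
    have h6 := h _ (h4 y hy).1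
    have h7 := Finset.sum_nonpos fun i (_ : i ∈ Finset.univ) =>
      mul_nonpos_of_nonneg_of_nonpos (hlam i) ((h4 y hy).2 i).le
    rw [lagr, map_add, h2, add_sub_cancel_left, inner_add_right] at h6
    rw [inner_neg_left, inner_add_left, hT, LinearMap.adjoint_inner_left]
    change -(inner ℝ P.c y + inner ℝ w (P.A y)) ≤ _
    linarith
  have h6 := singularValues_mul_norm_le T w
  rw [finrank_euclideanSpace_fin] at h6
  have h7 : T w = -P.c - -(P.c + T w) := by abel
  have h8 := norm_sub_le (-P.c) (-(P.c + T w))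
  rw [← h7, norm_neg P.c] at h8
  exact h6.trans (by linarith)

theorem sigmaMin_pos (hA : Function.Surjective P.A) (hr : 0 < r) : 0 < P.sigmaMin := by
  refine (LinearMap.injective_iff_forall_lt_finrank_singularValues_pos _).1 ?_ (r - 1)
    (by rw [finrank_euclideanSpace_fin]; omega)
  rw [injective_iff_map_eq_zero]
  intro w hw
  obtain ⟨x, hx⟩ := hA w
  have := LinearMap.adjoint_inner_left (P.A : Euc n →ₗ[ℝ] Euc r) x w
  rw [hw, inner_zero_left] at this
  have h2 : (inner ℝ w w : ℝ) = 0 := by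
    conv_lhs => rw [← hx]
    rw [hx]
    exact (this.trans (by rw [ContinuousLinearMap.coe_coe, hx])).symm
  exact inner_self_eq_zero.1 h2

/-- The multipliers lie in the interior of the bounded dual domain, with a uniform margin. -/
theorem exists_margin (hs : P.IsSlater D.xhat D.epsHat) (hA : Function.Surjective P.A) {v : ℝ}
    (hv : D.vlow < v) :
    ∃ δ > 0, ∀ (lam : Fin m → ℝ) (w : Euc r), (∀ i, 0 ≤ lam i) →
      (∀ x ∈ P.X, v ≤ P.lagr x lam w) →
        (∀ i, lam i + δ ≤ P.lambdaBar D) ∧ ∀ u, ‖u‖ ≤ δ → w + u ∈ P.W D := by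
  have h3 := hs.2.2.1
  have hf : ∀ i, P.f i D.xhat < 0 := fun i => by
    simpa using (hs.2.2.2 0 (by simpa using h3.le)).2 i
  have m1 : ∃ δ > 0, ∀ (lam : Fin m → ℝ) (w : Euc r), (∀ i, 0 ≤ lam i) →
      (∀ x ∈ P.X, v ≤ P.lagr x lam w) → ∀ i, lam i + δ ≤ P.lambdaBar D := by
    rcases isEmpty_or_nonempty (Fin m) with hm | hm
    · exact ⟨1, one_pos, fun lam w _ _ i => hm.elim i⟩
    · obtain ⟨j, hj⟩ := exists_eq_ciInf_of_finite (f := fun i => -P.f i D.xhat)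
      have hκ : 0 < ⨅ i, -P.f i D.xhat := by
        rw [← hj]
        exact neg_pos.2 (hf j)
      -- The margin is the difference between the multiplier bounds computed from `vlow` and from v;
      -- the bound on w is treated in the same way.
      refine ⟨(v - D.vlow) / ⨅ i, -P.f i D.xhat, div_pos (sub_pos.2 hv) hκ,
        fun lam w hlam h i => ?_⟩
      have h5 := mul_iInf_le_of_le_lagr hs hlam h i
      rw [lambdaBar, ← le_sub_iff_add_le, ← sub_div, le_div_iff₀ hκ]
      linarith
  have m2 : ∃ δ > 0, ∀ (lam : Fin m → ℝ) (w : Euc r), (∀ i, 0 ≤ lam i) →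
      (∀ x ∈ P.X, v ≤ P.lagr x lam w) → ∀ u, ‖u‖ ≤ δ → w + u ∈ P.W D := by
    rcases Nat.eq_zero_or_pos r with rfl | hr
    -- For r = 0 the space of w is a point, and only nonnegativity of `radW` is needed; this does
    -- not depend on the value at the truncated index r - 1.
    · refine ⟨1, one_pos, fun lam w hlam h u _ => ?_⟩
      have h5 := sigmaMin_mul_norm_le_of_le_lagr hs hlam h
      have hσ : 0 ≤ P.sigmaMin := LinearMap.singularValues_nonneg _ _
      have h6 := mul_nonneg hσ (norm_nonneg w)
      have h7 := div_le_div_of_nonneg_right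
        (show inner ℝ P.c D.xhat - v ≤ inner ℝ P.c D.xhat - D.vlow by linarith) h3.le
      have h8 : w + u = 0 := Subsingleton.elim _ _
      rw [h8]
      change ‖(0 : Euc 0)‖ ≤ _
      rw [norm_zero, radW]
      exact mul_nonneg (by positivity) (by linarith)
    · have hσ := sigmaMin_pos hA hr
      refine ⟨1 / P.sigmaMin * ((v - D.vlow) / D.epsHat),
        mul_pos (by positivity) (div_pos (sub_pos.2 hv) h3), fun lam w hlam h u hu => ?_⟩
      have h5 := sigmaMin_mul_norm_le_of_le_lagr hs hlam h
      have h6 : ‖w‖ ≤ 1 / P.sigmaMin * ((inner ℝ P.c D.xhat - v) / D.epsHat + ‖P.c‖) := by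
        rw [one_div, ← div_eq_inv_mul, le_div_iff₀ hσ]
        linarith
      have h7 : P.radW D = 1 / P.sigmaMin * ((inner ℝ P.c D.xhat - v) / D.epsHat + ‖P.c‖) +
          1 / P.sigmaMin * ((v - D.vlow) / D.epsHat) := by
        rw [radW]
        ring
      change ‖w + u‖ ≤ _
      linarith [norm_add_le w u]
  obtain ⟨δ₁, hδ₁, h₁⟩ := m1
  obtain ⟨δ₂, hδ₂, h₂⟩ := m2
  refine ⟨min δ₁ δ₂, lt_min hδ₁ hδ₂, fun lam w hlam h => ⟨fun i => ?_, fun u hu => ?_⟩⟩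
  · linarith [h₁ lam w hlam h i, min_le_left δ₁ δ₂]
  · exact h₂ lam w hlam h u (hu.trans (min_le_right _ _))

/-! ### Ergodic boundedness -/

/-- A bound on the Lagrangian over a neighbourhood of the multipliers extends to all dual
variables. -/
theorem lagr_sub_le_of_box {x : Euc n} {v B δ : ℝ} (hδ : 0 < δ)
    {lams : Fin m → ℝ} {ws : Euc r} (hlams : ∀ i, 0 ≤ lams i)
    (hbar : ∀ i, lams i + δ ≤ P.lambdaBar D) (hW : ∀ u, ‖u‖ ≤ δ → ws + u ∈ P.W D)
    (hv : v ≤ P.lagr x lams ws)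
    (hB : ∀ (lam : Fin m → ℝ) (w : Euc r), (∀ i, 0 ≤ lam i ∧ lam i ≤ P.lambdaBar D) →
      w ∈ P.W D → P.lagr x lam w - v ≤ B)
    {lam : Fin m → ℝ} (hlam : ∀ i, 0 ≤ lam i) (w : Euc r) :
    P.lagr x lam w - v ≤ B + ∑ i, lam i * (B / δ) + ‖w‖ * (B / δ) := by
  have hf : ∀ i, P.f i x ≤ B / δ := by
    intro i
    -- Raising one multiplier by δ stays in the domain and changes L by δ f_i(x), while L at (λ*,
    -- w*) is at least v.
    have h := hB (lams + Pi.single i δ) (ws + 0) (fun j => ?_) (hW 0 (by simpa using hδ.le))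
    · rw [lagr_add_single, add_zero] at h
      rw [le_div_iff₀ hδ]
      linarith
    · rcases eq_or_ne j i with rfl | hj
      · rw [Pi.add_apply, Pi.single_eq_same]
        exact ⟨by linarith [hlams j], hbar j⟩
      · rw [Pi.add_apply, Pi.single_eq_of_ne hj, add_zero]
        exact ⟨hlams j, by linarith [hbar j]⟩
  have hA : ‖P.A x - P.b‖ ≤ B / δ := by
    refine norm_le_div_of_inner_le hδ fun u hu => ?_
    have h := hB lams (ws + u) (fun j => ⟨hlams j, by linarith [hbar j]⟩) (hW u hu)
    rw [lagr_add_right] at h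
    linarith
  have hc : inner ℝ P.c x - v ≤ B := by
    have h := hB 0 0 (fun j => ⟨le_rfl, by
      change 0 ≤ _
      linarith [hbar j, hlams j]⟩) (by
        have h1 : ‖ws + 0‖ ≤ P.radW D := hW 0 (by simpa using hδ.le)
        change ‖(0 : Euc r)‖ ≤ _
        rw [norm_zero]
        exact (norm_nonneg _).trans h1)
    simpa [lagr] using h
  have h1 : ∑ i, lam i * P.f i x ≤ ∑ i, lam i * (B / δ) :=
    Finset.sum_le_sum fun i _ => mul_le_mul_of_nonneg_left (hf i) (hlam i)
  have h2 := (real_inner_le_norm w (P.A x - P.b)).trans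
    (mul_le_mul_of_nonneg_left hA (norm_nonneg w))
  rw [lagr]
  linarith

theorem phi_nonneg (htau : 0 < D.tau) (htheta : ∀ i, 0 < D.theta i) (hthetaW : 0 < D.thetaW) :
    0 ≤ P.phi D := by
  have : 0 ≤ ∑ i, D.theta i * P.gBlock D i ^ 2 :=
    Finset.sum_nonneg fun i _ => mul_nonneg (htheta i).le (sq_nonneg _)
  rw [phi]
  positivity

/-- A bound on the gap that is uniform over the runs and the bounded dual domain. -/
noncomputable def gapConst (P : RobustProblem n r m) (D : Params n m) : ℝ :=
  D.tau⁻¹ * (2 * radius P.X) ^ 2 + ∑ i, P.sigma i * (D.theta i)⁻¹ * P.lambdaBar D ^ 2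
    + 4 * D.thetaW⁻¹ * P.radW D ^ 2 + P.phi D

theorem sigma_nonneg (i : Fin m) : 0 ≤ P.sigma i := Finset.sum_nonneg fun _ _ => by positivity

theorem gapConst_nonneg (htau : 0 < D.tau) (htheta : ∀ i, 0 < D.theta i)
    (hthetaW : 0 < D.thetaW) : 0 ≤ P.gapConst D := by
  have h1 := phi_nonneg (P := P) htau htheta hthetaW
  have h2 : 0 ≤ ∑ i, P.sigma i * (D.theta i)⁻¹ * P.lambdaBar D ^ 2 :=
    Finset.sum_nonneg fun i _ =>
      mul_nonneg (mul_nonneg (sigma_nonneg i) (inv_nonneg.2 (htheta i).le)) (sq_nonneg _)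
  rw [gapConst]
  positivity

theorem IsRun.lagr_gap_le_gapConst {N : ℕ} {χ y dx dz} (h : P.IsRun D N χ y dx dz) (hN : 1 ≤ N)
    (hm : P.IsConvexModel)
    (hball : ∀ i, 0 < D.eps i ∧ Metric.closedBall 0 (D.eps i) ⊆ P.Zint i)
    (hmu : ∀ i, ∀ x ∈ P.feasible, -P.g i x 0 ≤ D.mu i)
    (htau : 0 < D.tau) (htheta : ∀ i, 0 < D.theta i) (hthetaW : 0 < D.thetaW)
    {x : Euc n} (hx : x ∈ P.feasible) {lam : Fin m → ℝ}
    (hlam : ∀ i, 0 ≤ lam i ∧ lam i ≤ P.lambdaBar D) {w : Euc r} (hw : w ∈ P.W D) :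
    P.lagr (ergodicMean N χ).fst lam w - inner ℝ P.c x ≤ 1 / (2 * √N) * P.gapConst D := by
  refine (h.lagr_gap_le hN hm hball hmu htau htheta hthetaW hx hlam hw).trans ?_
  refine mul_le_mul_of_nonneg_left ?_ (by positivity)
  have h1 : ‖x - (χ 0).fst‖ ≤ 2 * radius P.X := by
    have i1 := norm_sub_le x (χ 0).fst
    have i2 := le_radius hm.isCompact_X hx.1
    have i3 := le_radius hm.isCompact_X h.init_primal.1
    linarith
  have h2 : ∑ i, P.sigma i * (D.theta i)⁻¹ * max (lam i) ((y 0).1 i (P.top i)).snd ^ 2 ≤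
      ∑ i, P.sigma i * (D.theta i)⁻¹ * P.lambdaBar D ^ 2 := by
    refine Finset.sum_le_sum fun i _ => mul_le_mul_of_nonneg_left ?_
      (mul_nonneg (sigma_nonneg i) (inv_nonneg.2 (htheta i).le))
    exact pow_le_pow_left₀ ((hlam i).1.trans (le_max_left _ _))
      (max_le (hlam i).2 (h.init_dual.1 i (P.top i)).2.1) 2
  have h3 : max ‖w‖ ‖(y 0).2‖ ≤ P.radW D := max_le hw h.init_dual.2
  have h1' := mul_le_mul_of_nonneg_left (pow_le_pow_left₀ (norm_nonneg _) h1 2)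
    (inv_nonneg.2 htau.le)
  have h3' := mul_le_mul_of_nonneg_left
    (pow_le_pow_left₀ ((norm_nonneg w).trans (le_max_left _ _)) h3 2)
    (show 0 ≤ 4 * D.thetaW⁻¹ by positivity)
  rw [gapConst]
  linarith

theorem tendsto_one_div_two_mul_sqrt :
    Tendsto (fun N : ℕ => 1 / (2 * √(N : ℝ))) atTop (𝓝 0) := by
  have h : Tendsto (fun N : ℕ => 2 * √(N : ℝ)) atTop atTop :=
    (Real.tendsto_sqrt_atTop.comp tendsto_natCast_atTop_atTop).const_mul_atTop two_pos
  simp only [one_div]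
  exact h.inv_tendsto_atTop

theorem isErgodicallyBounded_sgsp (hm : P.IsConvexModel) (hopt : ∃ x, P.IsOptimal x)
    (hslater : P.IsSlater D.xhat D.epsHat) (hvlow : ∀ x ∈ P.feasible, D.vlow < inner ℝ P.c x)
    (hrank : Function.Surjective P.A)
    (hball : ∀ i, 0 < D.eps i ∧ Metric.closedBall 0 (D.eps i) ⊆ P.Zint i)
    (hmu : ∀ i, ∀ x ∈ P.feasible, -P.g i x 0 ≤ D.mu i)
    (htau : 0 < D.tau) (htheta : ∀ i, 0 < D.theta i) (hthetaW : 0 < D.thetaW) :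
    P.IsErgodicallyBounded (fun N => 1 / (2 * √N)) (P.sgsp D) := by
  refine ⟨fun N _ => by positivity, ?_, tendsto_one_div_two_mul_sqrt, ?_⟩
  · intro M hM N _ hMN
    have hM' : (0 : ℝ) < M := by exact_mod_cast hM
    have hMN' : (M : ℝ) ≤ N := by exact_mod_cast hMN
    have := Real.sqrt_pos.2 hM'
    exact one_div_le_one_div_of_le (by positivity)
      (mul_le_mul_of_nonneg_left (Real.sqrt_le_sqrt hMN') two_pos.le)
  obtain ⟨xo, hxo⟩ := hopt
  obtain ⟨δ, hδ, hmargin⟩ := exists_margin hslater hrank (hvlow xo hxo.1)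
  set C := P.gapConst D with hC
  have hC0 : 0 ≤ C := gapConst_nonneg htau htheta hthetaW
  -- C pays for the gap on the bounded domain, and each of the m + 1 linear terms in λ_i and ‖w‖
  -- costs one (C/δ)². The distance coefficient β is 0 because the mean lies in X.
  refine ⟨C + (m + 1) * (C / δ) ^ 2, 1, 0, 1, fun _ => 1, by positivity, one_pos, le_rfl, one_pos,
    fun _ => one_pos, ?_⟩
  rintro N hN x0 lam0 w0 xbar ⟨χ, y, dx, dz, hrun, -, -, -, rfl⟩ xs lams ws hsad
  obtain ⟨hxs, hval⟩ := hsad.isOptimal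
  -- All saddle points share the optimal value, so the margin δ, chosen from one optimal solution,
  -- serves all of them.
  have hv : (inner ℝ P.c xs : ℝ) = inner ℝ P.c xo :=
    le_antisymm (hxs.2 xo hxo.1) (hxo.2 xs hxs.1)
  have hcert : ∀ x ∈ P.X, inner ℝ P.c xs ≤ P.lagr x lams ws := by
    rw [← hval]
    exact hsad.2.2.2
  have hX := hrun.fst_ergodicMean_mem hN hm fun i => (hball i).1
  have hdist := Metric.infDist_zero_of_mem hX
  rw [hdist, hval]
  refine ⟨fun lam w α hlam _ => ?_, by linarith [hcert _ hX]⟩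
  obtain ⟨hbar, hW⟩ := hmargin lams ws hsad.2.1 (hv ▸ hcert)
  have hbox := lagr_sub_le_of_box hδ hsad.2.1 hbar hW (hcert _ hX)
    (fun lam w hlam hw => hrun.lagr_gap_le_gapConst hN hm hball hmu htau htheta hthetaW hxs.1
      hlam hw) hlam w
  beta_reduce
  have hψ : 0 ≤ 1 / (2 * √(N : ℝ)) := by positivity
  generalize 1 / (2 * √(N : ℝ)) = ψ at *
  rw [← hC] at hbox
  -- The box bound is itself ψC, so the slope carries a factor ψ and Young's inequality keeps the
  -- rate.
  have am : ∀ a : ℝ, a * (ψ * C / δ) ≤ ψ * (a ^ 2 + (C / δ) ^ 2) := fun a => by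
    rw [show a * (ψ * C / δ) = ψ * (a * (C / δ)) by ring]
    refine mul_le_mul_of_nonneg_left ?_ hψ
    nlinarith [sq_nonneg (a - C / δ), sq_nonneg a, sq_nonneg (C / δ)]
  have h1 : ∑ i, lam i * (ψ * C / δ) ≤
      ψ * ∑ i, max (lam i) (lam0 i) ^ 2 + ψ * (m * (C / δ) ^ 2) := by
    refine (Finset.sum_le_sum fun i _ => am (lam i)).trans ?_
    rw [← Finset.mul_sum, Finset.sum_add_distrib, mul_add]
    refine add_le_add (mul_le_mul_of_nonneg_left (Finset.sum_le_sum fun i _ =>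
      pow_le_pow_left₀ (hlam i) (le_max_left _ _) 2) hψ) (le_of_eq ?_)
    rw [Finset.sum_const, Finset.card_univ, Fintype.card_fin, nsmul_eq_mul]
  have h2 : ‖w‖ * (ψ * C / δ) ≤ ψ * max ‖w‖ ‖w0‖ ^ 2 + ψ * (C / δ) ^ 2 := by
    have := mul_le_mul_of_nonneg_left
      (pow_le_pow_left₀ (norm_nonneg w) (le_max_left ‖w‖ ‖w0‖) 2) hψ
    linarith [am ‖w‖]
  have h3 : ψ * (C + (m + 1) * (C / δ) ^ 2) ≤
      ψ * ((C + (m + 1) * (C / δ) ^ 2) * (1 + α ^ 2)) := by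
    refine mul_le_mul_of_nonneg_left ?_ hψ
    have : 0 ≤ C + (m + 1) * (C / δ) ^ 2 := by positivity
    nlinarith [mul_nonneg this (sq_nonneg α)]
  have h4 : 0 ≤ ψ * ‖xs - x0‖ ^ 2 := by positivity
  simp only [inv_one, one_mul, mul_zero, add_zero]
  linarith

end RobustProblem

end RobustSGSP

theorem mainTheorem6 {n r m : ℕ} (P : RobustSGSP.RobustProblem n r m)
    (D : RobustSGSP.Params n m)
    (hmodel : P.IsConvexModel)
    (hopt : ∃ x, P.IsOptimal x)
    (hslater : P.IsSlater D.xhat D.epsHat)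
    (hvlow : ∀ x ∈ P.feasible, D.vlow < inner ℝ P.c x)
    (hrank : Function.Surjective P.A)
    (hball : ∀ i, 0 < D.eps i ∧ Metric.closedBall 0 (D.eps i) ⊆ P.Zint i)
    (hmu : ∀ i, 0 < D.mu i ∧ ∀ x ∈ P.feasible, -P.g i x 0 ≤ D.mu i)
    (htau : 0 < D.tau) (htheta : ∀ i, 0 < D.theta i) (hthetaW : 0 < D.thetaW) :
    (∀ N : ℕ, 1 ≤ N → ∀ χ y dx dz, P.IsRun D N χ y dx dz →
      -- the gap of the expanded Lagrangian
      (∀ χ' ∈ P.primalDomain D, ∀ y' ∈ P.dualDomain D,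
        P.expLagr (RobustSGSP.ergodicMean N χ) y' - P.expLagr χ' (RobustSGSP.ergodicMean N y) ≤
          1 / (2 * √N) *
            (‖χ 0 - χ'‖ ^ 2 / D.tau + D.tau * P.gPrimal D ^ 2
              + ∑ i, (‖(y 0).1 i - y'.1 i‖ ^ 2 / D.theta i + D.theta i * P.gBlock D i ^ 2)
              + ‖(y 0).2 - y'.2‖ ^ 2 / D.thetaW + D.thetaW * P.gW ^ 2)) ∧
      -- the gaps of the original Lagrangian
      (∀ xs, P.IsOptimal xs → ∀ lams ws, P.IsDualOptimal lams ws →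
        (∀ (lam : Fin m → ℝ) (w : RobustSGSP.Euc r),
          (∀ i, 0 ≤ lam i ∧ lam i ≤ P.lambdaBar D) → w ∈ P.W D →
          P.lagr (RobustSGSP.ergodicMean N χ).fst lam w - P.lagr xs lams ws ≤
            1 / (2 * √N) *
              (D.tau⁻¹ * ‖xs - (χ 0).fst‖ ^ 2
                + ∑ i, P.sigma i * (D.theta i)⁻¹ *
                    max (lam i) ((y 0).1 i (P.top i)).snd ^ 2
                + 4 * D.thetaW⁻¹ * max ‖w‖ ‖(y 0).2‖ ^ 2 + P.phi D)) ∧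
        inner ℝ P.c xs ≤ P.lagr (RobustSGSP.ergodicMean N χ).fst lams ws)) ∧
    -- ergodic boundedness
    P.IsErgodicallyBounded (fun N => 1 / (2 * √N)) (P.sgsp D) := by
  have h0 : ∀ i, (0 : RobustSGSP.Euc (P.d i)) ∈ P.Zint i := fun i =>
    (hball i).2 (by simpa using (hball i).1.le)
  have heps := fun i => (hball i).1
  have hmu' := fun i => (hmu i).2
  refine ⟨fun N hN χ y dx dz hrun => ⟨fun χ' hχ' y' hy' => ?_, fun xs hxs lams ws hdual => ?_⟩,
    RobustSGSP.RobustProblem.isErgodicallyBounded_sgsp hmodel hopt hslater hvlow hrank hball hmu'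
      htau htheta hthetaW⟩
  · exact hrun.expLagr_gap_le hN hmodel heps (fun i => Set.mem_iInter.1 (h0 i)) htau htheta hthetaW
      hχ' hy'
  · have hle := hdual.le_lagr hmodel h0 hslater hrank hxs
    refine ⟨fun lam w hlam hw => ?_, hle _ (hrun.fst_ergodicMean_mem hN hmodel heps)⟩
    -- Only L(x*, (λ*, w*)) ≥ cᵀx* is needed to replace the saddle value by cᵀx*.
    refine (sub_le_sub_left (hle xs hxs.1.1) _).trans ?_
    exact hrun.lagr_gap_le hN hmodel hball hmu' htau htheta hthetaW hxs.1 hlam hw
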